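/- Let $d\ge 1$ and let $(\mathbb{R}^d,\cdot)$ be a connected, simply connected nilpotent Lie group, written in canonical coordinates of the first kind (so that the identity is $0$ and $t\mapsto tx$ is a one-parameter subgroup for every $x$), with Lie algebra $\mathfrak{g}$. Let $X=(X_1,\dots,X_k)$ be linearly independent left-invariant vector fields such that, with $\mathcal{H}^0=\operatorname{span}(X)$ and $\mathcal{H}^{n}=\mathcal{H}^{n-1}+[\mathcal{H}^{n-1},\mathcal{H}^0]$, one has $\mathcal{H}^s=\mathfrak{g}$ for some $s$. Let $K\subset\mathcal{H}^0_0$ be a compact convex set in the horizontal space at $0$ that contains $0$ in its interior relative to $\mathcal{H}^0_0$, let $\|u\|_K=\inf\{\lambda\ge 0: u\in\lambda K\}$ on $\mathcal{H}^0_0$, and extend $\|\cdot\|_K$ to all of $\mathcal{H}^0$ by left translation. Let $g$ be a left-invariant Riemannian metric for which $X_1,\dots,X_k$ are orthonormal, and let $\operatorname{div}$ be its divergence. Write $|E|$ for the Lebesgue measure of $E$ and, for a Lebesgue measurable set $E\subseteq\mathbb{R}^d$, put $$P_K(E)=\sup\Big\{\int_E\operatorname{div}(U)\,dx:\ U \text{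 a horizontal } C^1 \text{ vector field with compact support},\ \sup_{p}\|U_p\|_K\le 1\Big\};$$ $E$ has finite perimeter if $P_K(E)<\infty$. Let $F\subseteq\mathbb{R}^d$ be a set of finite perimeter with $|F|<\infty$ and nonempty interior. Then there are constants $C_3>0$, $\lambda_0>0$, $\lambda_1\in(0,+\infty]$ and a family $\{F^\lambda\}_{-\lambda_0<\lambda<\lambda_1}$ of sets of finite perimeter such that, for all $\lambda$ with $-\lambda_0<\lambda<\lambda_1$, $$|F^\lambda|=|F|+\lambda\qquad\text{and}\qquad P_K(F^\lambda)-P_K(F)\le C_3|\lambda|.$$ Moreover, if $F$ is bounded, then $\lambda_1$ can be taken to be $+\infty$. -/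

import Mathlib

open MeasureTheory

/-- The underlying space `ℝ^d`, with its Euclidean norm and Lebesgue measure `volume`. -/
abbrev Rd (d : ℕ) : Type := EuclideanSpace ℝ (Fin d)

/-- For a product `mul` on `ℝ^d` with identity `0`: the left-invariant vector field that takes the
value `a` at the identity, `x ↦ d(ℓ_x)_0 a`, where `ℓ_x = mul x`. -/
noncomputable def leftField {d : ℕ} (mul : Rd d → Rd d → Rd d) (a x : Rd d) : Rd d :=
  fderiv ℝ (mul x) 0 a

/-- The Lie bracket on the Lie algebra `T_0 ℝ^d = ℝ^d`: the value at `0` of the Lie bracket of the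
left-invariant vector fields that extend `a` and `b`. -/
noncomputable def algBracket {d : ℕ} (mul : Rd d → Rd d → Rd d) (a b : Rd d) : Rd d :=
  VectorField.lieBracket ℝ (leftField mul a) (leftField mul b) 0

/-- The subspace `[S, T]` spanned by the brackets `[a, b]` with `a ∈ S` and `b ∈ T`. -/
noncomputable def bracketSpan {d : ℕ} (mul : Rd d → Rd d → Rd d) (S T : Submodule ℝ (Rd d)) :
    Submodule ℝ (Rd d) :=
  Submodule.span ℝ {c | ∃ a ∈ S, ∃ b ∈ T, c = algBracket mul a b}

/-- The lower central series `𝔤_0 = 𝔤`, `𝔤_{i+1} = [𝔤, 𝔤_i]`. -/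
noncomputable def lowerSeries {d : ℕ} (mul : Rd d → Rd d → Rd d) : ℕ → Submodule ℝ (Rd d)
  | 0 => ⊤
  | i + 1 => bracketSpan mul ⊤ (lowerSeries mul i)

/-- The series `H^0 = H`, `H^{n+1} = H^n + [H^n, H^0]` generated by a subspace `H`. -/
noncomputable def horizontalSeries {d : ℕ} (mul : Rd d → Rd d → Rd d) (H : Submodule ℝ (Rd d)) :
    ℕ → Submodule ℝ (Rd d)
  | 0 => H
  | n + 1 => horizontalSeries mul H n ⊔ bracketSpan mul (horizontalSeries mul H n) H

/-- A connected, simply connected nilpotent Lie group of dimension `d`, identified with `ℝ^d`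
through canonical coordinates of the first kind. The last condition but one says that
`t ↦ t x` is the one-parameter subgroup with initial velocity `x`, that is, that the exponential
map is the identity of `ℝ^d`; it contains the laws `x · 0 = 0 · x = x` and
`x · (-x) = (-x) · x = 0`. The coordinates may be taken with respect to any basis of the Lie
algebra, in particular with respect to a Malcev basis. -/
structure NilpotentGroup (d : ℕ) where
  mul : Rd d → Rd d → Rd d
  contDiff_mul : ContDiff ℝ (⊤ : ℕ∞) (fun p : Rd d × Rd d => mul p.1 p.2)
  mul_assoc : ∀ x y z, mul (mul x y) z = mul x (mul y z)
  exp_coord : ∀ (s t : ℝ) (x : Rd d), mul (s • x) (t • x) = (s + t) • x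
  nilpotent : ∃ r, lowerSeries mul r = ⊥

/-- A sub-Finsler nilpotent group `(ℝ^d, ·, X, K)`, together with the auxiliary left-invariant
Riemannian metric. A left-invariant vector field is given by its value at the identity. -/
structure SubFinslerGroup (d k : ℕ) extends NilpotentGroup d where
  /-- the left-invariant frame `X_1, …, X_k` of the horizontal distribution -/
  X : Fin k → Rd d
  linearIndependent_X : LinearIndependent ℝ X
  bracket_generating : ∃ s, horizontalSeries mul (Submodule.span ℝ (Set.range X)) s = ⊤
  /-- the convex body in the horizontal space at the identity; its interior is taken there -/
  K : Set (Submodule.span ℝ (Set.range X))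
  convex_K : Convex ℝ K
  isCompact_K : IsCompact K
  zero_mem_interior_K : (0 : Submodule.span ℝ (Set.range X)) ∈ interior K
  /-- the value at the identity of the left-invariant Riemannian metric -/
  g₀ : LinearMap.BilinForm ℝ (Rd d)
  g₀_symm : ∀ u v, g₀ u v = g₀ v u
  g₀_pos : ∀ u, u ≠ 0 → 0 < g₀ u u
  g₀_orthonormal : ∀ i j, g₀ (X i) (X j) = if i = j then 1 else 0

namespace SubFinslerGroup

variable {d k : ℕ}

/-- The horizontal space at the identity. -/
abbrev horizontal (S : SubFinslerGroup d k) : Submodule ℝ (Rd d) :=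
  Submodule.span ℝ (Set.range S.X)

/-- The left-invariant Riemannian metric `g`; here `-p` is the inverse of `p`, so that the
derivative of `ℓ_{-p}` at `p` carries tangent vectors at `p` back to the identity. -/
noncomputable def metric (S : SubFinslerGroup d k) (p u v : Rd d) : ℝ :=
  S.g₀ (fderiv ℝ (S.mul (-p)) p u) (fderiv ℝ (S.mul (-p)) p v)

/-- The density `√(det g_ij)` of the Riemannian volume. -/
noncomputable def density (S : SubFinslerGroup d k) (p : Rd d) : ℝ :=
  Real.sqrt (Matrix.det (Matrix.of fun i j : Fin d =>
    S.metric p (EuclideanSpace.single i 1) (EuclideanSpace.single j 1)))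

/-- The divergence with respect to `g`, that is, `(det g)^(-1/2) ∑ ∂_i ((det g)^(1/2) U_i)`. -/
noncomputable def divergence (S : SubFinslerGroup d k) (U : Rd d → Rd d) (p : Rd d) : ℝ :=
  (S.density p)⁻¹ *
    ∑ i : Fin d, fderiv ℝ (fun y => S.density y * U y i) p (EuclideanSpace.single i 1)

/-- The horizontal vector fields `U` of class `C^1` with compact support and `‖U‖_{K,∞} ≤ 1`. The
norm of the horizontal vector `d(ℓ_p)_0 v` at `p` is `‖v‖_K`, the gauge of `K` at `v`. -/
def Admissible (S : SubFinslerGroup d k) (U : Rd d → Rd d) : Prop :=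
  ContDiff ℝ 1 U ∧ HasCompactSupport U ∧
    ∀ p, ∃ v : S.horizontal, U p = leftField S.mul (v : Rd d) p ∧ gauge S.K v ≤ 1

/-- The `K`-perimeter `P_K(E) = sup {∫_E div U dx}` over the admissible fields `U`. As `U = 0` is
admissible, the supremum is nonnegative and negative integrals may be replaced by `0`. -/
noncomputable def perimeter (S : SubFinslerGroup d k) (E : Set (Rd d)) : ENNReal :=
  ⨆ (U : Rd d → Rd d) (_ : S.Admissible U), ENNReal.ofReal (∫ x in E, S.divergence U x)

/-- Sets of finite perimeter: Lebesgue measurable sets with `P_K(E) < ∞`. -/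
def FinitePerimeter (S : SubFinslerGroup d k) (E : Set (Rd d)) : Prop :=
  NullMeasurableSet E volume ∧ S.perimeter E < ⊤

end SubFinslerGroup

/-! The theorem follows from concavity of the isoperimetric profile `I(v)`, the infimum of the
perimeters of sets of measure `v`. Take `E` of measure `v` and a left translate `A` of it. The
translate has the same measure and no larger perimeter, and perimeter is submodular: `P(E ∪ A) + P(E
∩ A) ≤ P(E) + P(A)`. The overlap `|E ∩ A|` depends continuously on the translation and can be made
arbitrarily small, so it takes every value `v - s` with `0 < s < v`; then `|E ∪ A| = v + s`. Hence
`I(v + s) + I(v - s) ≤ 2 I(v)`.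

A nonnegative midpoint concave function on the positive half-line is nondecreasing and satisfies
`I(v + l) ≤ I(v) + C |l|` for all `l > -v`. A set of measure `|F| + l` whose perimeter is within
`|l|` of the infimum then does what is asked. The argument never uses that `F` is bounded, so `λ₁ =
+∞` always works.

Two facts carry the geometry. Left translations have Jacobian one (`det_coframe`), because the
derivative of the exponential map is unipotent in a nilpotent group; this makes Lebesgue measure
invariant and the Riemannian divergence Euclidean. Submodularity
(`perimeter_union_add_perimeter_inter_le`) is proved for smoothed maxima and minima of `C^1`
functions, where it reduces to convexity of the set of admissible fields, and passes to sets by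
mollification along the group. -/

namespace NilpotentGroup

variable {d : ℕ} (G : NilpotentGroup d)

/-! ### Group laws, left translations and the left-invariant frame -/

lemma mul_zero (x : Rd d) : G.mul x 0 = x := by simpa using G.exp_coord 1 0 x

lemma zero_mul (x : Rd d) : G.mul 0 x = x := by simpa using G.exp_coord 0 1 x

lemma mul_neg_self (x : Rd d) : G.mul x (-x) = 0 := by simpa using G.exp_coord 1 (-1) x

lemma neg_mul_self (x : Rd d) : G.mul (-x) x = 0 := by simpa using G.exp_coord (-1) 1 x

lemma neg_mul_cancel_left (x y : Rd d) : G.mul (-x) (G.mul x y) = y := by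
  rw [← G.mul_assoc, G.neg_mul_self, G.zero_mul]

lemma mul_neg_cancel_left (x y : Rd d) : G.mul x (G.mul (-x) y) = y := by
  rw [← G.mul_assoc, G.mul_neg_self, G.zero_mul]

lemma neg_mul_rev (x y : Rd d) : -(G.mul x y) = G.mul (-y) (-x) := by
  have h : G.mul (G.mul x y) (G.mul (-y) (-x)) = 0 := by
    rw [G.mul_assoc, G.mul_neg_cancel_left, G.mul_neg_self]
  have := G.neg_mul_cancel_left (G.mul x y) (G.mul (-y) (-x))
  rw [h, G.mul_zero] at this
  exact this

lemma contDiff_mul_left (g : Rd d) : ContDiff ℝ (⊤ : ℕ∞) (G.mul g) :=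
  G.contDiff_mul.comp (contDiff_const.prodMk contDiff_id)

lemma contDiff_mul_right (g : Rd d) : ContDiff ℝ (⊤ : ℕ∞) (fun x => G.mul x g) :=
  G.contDiff_mul.comp (contDiff_id.prodMk contDiff_const)

lemma differentiable_mul_left (g : Rd d) : Differentiable ℝ (G.mul g) :=
  (G.contDiff_mul_left g).differentiable (by simp)

lemma differentiable_mul_right (g : Rd d) : Differentiable ℝ (fun x => G.mul x g) :=
  (G.contDiff_mul_right g).differentiable (by simp)

lemma continuous_mul : Continuous (fun p : Rd d × Rd d => G.mul p.1 p.2) :=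
  G.contDiff_mul.continuous

lemma continuous_mul_left (g : Rd d) : Continuous (G.mul g) :=
  (G.contDiff_mul_left g).continuous

/-- Left translation as a homeomorphism. -/
def leftHomeo (g : Rd d) : Rd d ≃ₜ Rd d where
  toFun := G.mul g
  invFun := G.mul (-g)
  left_inv := G.neg_mul_cancel_left g
  right_inv := G.mul_neg_cancel_left g
  continuous_toFun := G.continuous_mul_left g
  continuous_invFun := G.continuous_mul_left (-g)

/-- The left-invariant frame: the derivative at the identity of the left translation by `p`. -/
noncomputable def frame (p : Rd d) : Rd d →L[ℝ] Rd d := fderiv ℝ (G.mul p) 0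

/-- The derivative at `p` of the left translation by the inverse of `p`. -/
noncomputable def coframe (p : Rd d) : Rd d →L[ℝ] Rd d := fderiv ℝ (G.mul (-p)) p

lemma contDiff_frame : ContDiff ℝ (⊤ : ℕ∞) G.frame :=
  ContDiff.fderiv (f := G.mul) (m := (⊤ : ℕ∞)) G.contDiff_mul contDiff_const (by simp)

lemma contDiff_coframe : ContDiff ℝ (⊤ : ℕ∞) G.coframe :=
  ContDiff.fderiv (f := fun p => G.mul (-p)) (m := (⊤ : ℕ∞))
    (G.contDiff_mul.comp (contDiff_fst.neg.prodMk contDiff_snd)) contDiff_id (by simp)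

lemma frame_zero : G.frame 0 = ContinuousLinearMap.id ℝ _ := by
  have : G.mul 0 = id := funext G.zero_mul
  rw [frame, this, fderiv_id]

lemma coframe_zero : G.coframe 0 = ContinuousLinearMap.id ℝ _ := by
  have : G.mul (-0) = id := by rw [neg_zero]; exact funext G.zero_mul
  rw [coframe, this, fderiv_id]

lemma fderiv_mul_left_comp (g q r : Rd d) :
    (fderiv ℝ (G.mul g) (G.mul q r)).comp (fderiv ℝ (G.mul q) r) =
      fderiv ℝ (G.mul (G.mul g q)) r := by
  have : G.mul (G.mul g q) = G.mul g ∘ G.mul q := funext fun x => G.mul_assoc g q x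
  rw [this, fderiv_comp _ (G.differentiable_mul_left g _) (G.differentiable_mul_left q _)]

lemma fderiv_mul_left_comp_frame (g q : Rd d) :
    (fderiv ℝ (G.mul g) q).comp (G.frame q) = G.frame (G.mul g q) := by
  have := G.fderiv_mul_left_comp g q 0
  rwa [G.mul_zero] at this

lemma coframe_comp_frame (p : Rd d) :
    (G.coframe p).comp (G.frame p) = ContinuousLinearMap.id ℝ _ := by
  rw [coframe, G.fderiv_mul_left_comp_frame, G.neg_mul_self, G.frame_zero]

lemma frame_comp_coframe (p : Rd d) :
    (G.frame p).comp (G.coframe p) = ContinuousLinearMap.id ℝ _ := by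
  have := G.fderiv_mul_left_comp p (-p) p
  have h0 : G.mul 0 = id := funext G.zero_mul
  rw [G.neg_mul_self, G.mul_neg_self, h0, fderiv_id] at this
  exact this

/-! ### The derivative of the exponential map -/

/-- The derivative of the exponential map along `t ↦ t x`, carried back to the identity. -/
noncomputable def dexp (x : Rd d) (t : ℝ) : Rd d →L[ℝ] Rd d := t • G.coframe (t • x)

/-- The adjoint action of the inverse of `s x`. -/
noncomputable def adNeg (x : Rd d) (s : ℝ) : Rd d →L[ℝ] Rd d :=
  (G.coframe (s • x)).comp (fderiv ℝ (fun z => G.mul z (s • x)) 0)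

/-- Differentiate `(t y) · (s y) = (t + s) y` in `y` at `x` and carry the result back to the
identity. Differentiating this cocycle law at `s = 0` gives the equation `Y' = 1 + D Y` used in
`det_coframe`. -/
lemma dexp_add (x : Rd d) (t s : ℝ) :
    G.dexp x (t + s) = (G.adNeg x s).comp (G.dexp x t) + G.dexp x s := by
  suffices h : (t + s) • ContinuousLinearMap.id ℝ (Rd d) =
      (G.frame ((t + s) • x)).comp ((G.adNeg x s).comp (G.dexp x t) + G.dexp x s) by
    have h2 := congrArg (fun L => (G.coframe ((t + s) • x)).comp L) h
    simp only [← ContinuousLinearMap.comp_assoc, coframe_comp_frame] at h2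
    simpa [dexp] using h2
  have hm : HasFDerivAt (fun p : Rd d × Rd d => G.mul p.1 p.2)
      (fderiv ℝ (fun p : Rd d × Rd d => G.mul p.1 p.2) (t • x, s • x)) (t • x, s • x) :=
    (G.contDiff_mul.differentiable (by simp) _).hasFDerivAt
  set L := fderiv ℝ (fun p : Rd d × Rd d => G.mul p.1 p.2) (t • x, s • x) with hL
  have h1 : fderiv ℝ (G.mul (t • x)) (s • x) = L.comp (ContinuousLinearMap.inr ℝ _ _) := by
    have := hm.comp (s • x) (hasFDerivAt_prodMk_right (𝕜 := ℝ) (t • x) (s • x))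
    exact this.fderiv
  have h2 : fderiv ℝ (fun z => G.mul z (s • x)) (t • x) =
      L.comp (ContinuousLinearMap.inl ℝ _ _) := by
    have := hm.comp (t • x) (hasFDerivAt_prodMk_left (𝕜 := ℝ) (t • x) (s • x))
    exact this.fderiv
  have h3 : L.comp ((t • ContinuousLinearMap.id ℝ (Rd d)).prod
      (s • ContinuousLinearMap.id ℝ (Rd d))) = (t + s) • ContinuousLinearMap.id ℝ (Rd d) := by
    have h := hm.comp x (((hasFDerivAt_id (𝕜 := ℝ) x).const_smul t).prodMk
      ((hasFDerivAt_id (𝕜 := ℝ) x).const_smul s))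
    have h' : HasFDerivAt (fun x : Rd d => (t + s) • x)
        ((t + s) • ContinuousLinearMap.id ℝ (Rd d)) x := (hasFDerivAt_id x).const_smul (t + s)
    refine h.unique (h'.congr_of_eventuallyEq (Filter.Eventually.of_forall fun y => ?_))
    exact G.exp_coord t s y
  have h4 : (t + s) • ContinuousLinearMap.id ℝ (Rd d) =
      t • fderiv ℝ (fun z => G.mul z (s • x)) (t • x) +
        s • fderiv ℝ (G.mul (t • x)) (s • x) := by
    rw [← h3, h1, h2]
    ext1 v
    simp only [ContinuousLinearMap.comp_apply, add_apply,
      smul_apply, ContinuousLinearMap.inl_apply, ContinuousLinearMap.inr_apply,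
      ContinuousLinearMap.prod_apply, ContinuousLinearMap.id_apply, ← map_smul, ← map_add]
    simp
  have hA : (G.frame ((t + s) • x)).comp (G.coframe (s • x)) =
      fderiv ℝ (G.mul (t • x)) (s • x) := by
    have := G.fderiv_mul_left_comp_frame (t • x) (s • x)
    rw [G.exp_coord] at this
    rw [← this, ContinuousLinearMap.comp_assoc, frame_comp_coframe, ContinuousLinearMap.comp_id]
  -- Right translations commute with left ones, so the derivative of a right translation at `t x` is
  -- determined by its derivative at the identity.
  have hB : (fderiv ℝ (G.mul (t • x)) (s • x)).comp
      ((fderiv ℝ (fun z => G.mul z (s • x)) 0).comp (G.coframe (t • x))) =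
      fderiv ℝ (fun z => G.mul z (s • x)) (t • x) := by
    have e : (fun z => G.mul z (s • x)) ∘ G.mul (t • x) =
        G.mul (t • x) ∘ fun z => G.mul z (s • x) := funext fun z => G.mul_assoc _ _ _
    have h5 := fderiv_comp (0 : Rd d) (G.differentiable_mul_right (s • x) (G.mul (t • x) 0))
      (G.differentiable_mul_left (t • x) 0)
    have h6 := fderiv_comp (0 : Rd d) (G.differentiable_mul_left (t • x) (G.mul 0 (s • x)))
      (G.differentiable_mul_right (s • x) 0)
    rw [G.mul_zero] at h5
    rw [G.zero_mul] at h6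
    rw [← ContinuousLinearMap.comp_assoc, ← h6]
    change (fderiv ℝ (G.mul (t • x) ∘ fun z => G.mul z (s • x)) 0).comp _ = _
    rw [← e, h5]
    change ((fderiv ℝ (fun z => G.mul z (s • x)) (t • x)).comp (G.frame (t • x))).comp _ = _
    rw [ContinuousLinearMap.comp_assoc, frame_comp_coframe, ContinuousLinearMap.comp_id]
  rw [h4, ContinuousLinearMap.comp_add, dexp, dexp, adNeg]
  simp only [ContinuousLinearMap.comp_smul]
  rw [← hB, ← hA]
  simp only [ContinuousLinearMap.comp_assoc]

end NilpotentGroup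

/-! ### Nilpotent linear algebra and linear differential equations -/

lemma LinearMap.det_one_add_of_isNilpotent {E : Type*} [AddCommGroup E] [Module ℝ E]
    [FiniteDimensional ℝ E] {N : E →ₗ[ℝ] E} (hN : IsNilpotent N) :
    LinearMap.det (1 + N) = 1 := by
  have h := LinearMap.eval_charpoly (-N) 1
  rw [IsNilpotent.charpoly_eq_X_pow_finrank hN.neg] at h
  simpa using h.symm

/-- If `Z' = D Z` with `D` nilpotent and `Z 0 = 0`, then `Z` vanishes. -/
lemma eq_zero_of_hasDerivAt_mul_of_isNilpotent {A : Type*} [NormedRing A] [NormedAlgebra ℝ A]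
    {D : A} {r : ℕ} (hD : D ^ r = 0) {Z : ℝ → A} (hZ : ∀ t, HasDerivAt Z (D * Z t) t)
    (h0 : Z 0 = 0) (t : ℝ) : Z t = 0 := by
  -- The derivative of `D ^ (r - j - 1) * Z` is `D ^ (r - j) * Z`, which vanishes by the previous
  -- case; so the function is constant, and it is zero at `0`.
  have key : ∀ j ≤ r, ∀ t, D ^ (r - j) * Z t = 0 := by
    intro j
    induction j with
    | zero => intro _ t; simp [hD]
    | succ j ih =>
      intro hj t
      have hd : ∀ t, HasDerivAt (fun t => D ^ (r - (j + 1)) * Z t) 0 t := by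
        intro t
        have h := (hZ t).const_mul (D ^ (r - (j + 1)))
        rw [← mul_assoc, ← pow_succ, show r - (j + 1) + 1 = r - j by omega,
          ih (by omega) t] at h
        exact h
      have := is_const_of_deriv_eq_zero (fun t => (hd t).differentiableAt)
        (fun t => (hd t).deriv) t 0
      rw [this, h0, MulZeroClass.mul_zero]
  simpa using key r le_rfl t

/-- The solution of `Y' = 1 + D Y`, `Y 0 = 0` for nilpotent `D` is a polynomial in `D`. -/
lemma eq_sum_of_hasDerivAt_one_add_mul {A : Type*} [NormedRing A] [NormedAlgebra ℝ A]
    {D : A} {r : ℕ} (hD : D ^ r = 0) {Y : ℝ → A} (hY : ∀ t, HasDerivAt Y (1 + D * Y t) t)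
    (h0 : Y 0 = 0) (t : ℝ) :
    Y t = ∑ n ∈ Finset.range r, (t ^ (n + 1) / (n + 1).factorial) • D ^ n := by
  set P : ℝ → A := fun t => ∑ n ∈ Finset.range r, (t ^ (n + 1) / (n + 1).factorial) • D ^ n
    with hP
  have hP' : ∀ t, HasDerivAt P (1 + D * P t) t := by
    intro t
    have h1 : HasDerivAt P (∑ n ∈ Finset.range r, (t ^ n / n.factorial) • D ^ n) t := by
      refine HasDerivAt.fun_sum fun n _ => ?_
      have h := ((hasDerivAt_pow (n + 1) t).div_const ((n + 1).factorial : ℝ)).smul_const (D ^ n)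
      convert h using 2
      rw [Nat.factorial_succ]
      push_cast
      have : ((n : ℝ) + 1) ≠ 0 := by positivity
      field_simp
    have h2 : (1 : A) + D * P t = ∑ n ∈ Finset.range (r + 1), (t ^ n / n.factorial) • D ^ n := by
      rw [Finset.sum_range_succ', add_comm]
      simp only [hP, Finset.mul_sum, pow_zero, Nat.factorial_zero, Nat.cast_one, div_one, one_smul]
      congr 1
      refine Finset.sum_congr rfl fun n _ => ?_
      rw [mul_smul_comm, pow_succ' D]
    rw [h2, Finset.sum_range_succ, hD, smul_zero, add_zero]
    exact h1
  have hz := eq_zero_of_hasDerivAt_mul_of_isNilpotent hD (Z := fun t => Y t - P t)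
    (fun t => by
      have h := (hY t).sub (hP' t)
      rwa [add_sub_add_left_eq_sub, ← mul_sub] at h) (by simp [h0, hP]) t
  exact sub_eq_zero.mp hz

/-- The term `n = 0` of the polynomial solution is `1`, and every other term contains a factor `D`.
The exponent `r + 1` ensures that the term `n = 0` is present. -/
lemma exists_eq_one_add_mul_of_hasDerivAt {A : Type*} [NormedRing A] [NormedAlgebra ℝ A]
    {D : A} {r : ℕ} (hD : D ^ (r + 1) = 0) {Y : ℝ → A}
    (hY : ∀ t, HasDerivAt Y (1 + D * Y t) t) (h0 : Y 0 = 0) :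
    ∃ Q, Commute D Q ∧ Y 1 = 1 + D * Q := by
  refine ⟨∑ n ∈ Finset.range r, ((1 : ℝ) ^ (n + 1 + 1) / (n + 1 + 1).factorial) • D ^ n, ?_, ?_⟩
  · refine Commute.sum_right _ _ _ fun n _ => ?_
    exact ((Commute.refl D).pow_right n).smul_right _
  · rw [eq_sum_of_hasDerivAt_one_add_mul hD hY h0 1, Finset.sum_range_succ', Finset.mul_sum,
      add_comm]
    simp [pow_succ']

lemma ContinuousLinearMap.det_comp' {E : Type*} [NormedAddCommGroup E] [NormedSpace ℝ E]
    (A B : E →L[ℝ] E) : (A.comp B).det = A.det * B.det :=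
  LinearMap.det_comp _ _

/-! ### Unimodularity of left translations -/

namespace NilpotentGroup

variable {d : ℕ} (G : NilpotentGroup d)

lemma leftField_zero (a : Rd d) : leftField G.mul a 0 = a := by
  change G.frame 0 a = a
  rw [frame_zero]; rfl

/-- This is `d/ds Ad(exp(-s x)) = -ad x` at `s = 0`. Both factors are differentiated through the
second derivative of the product at the origin: its symmetry turns the right-translation factor into
the derivative of the field of `x`, and `coframe ∘ frame = id` gives minus the derivative of the
field of `v`. -/
lemma hasDerivAt_adNeg (x : Rd d) :
    ∃ D : Rd d →L[ℝ] Rd d, HasDerivAt (G.adNeg x) D 0 ∧ ∀ v, D v = -algBracket G.mul x v := by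
  set m : Rd d × Rd d → Rd d := fun p => G.mul p.1 p.2 with hm
  have hmc : ContDiff ℝ (⊤ : ℕ∞) m := G.contDiff_mul
  have hmd : ∀ p, HasFDerivAt m (fderiv ℝ m p) p := fun p =>
    (hmc.differentiable (by simp) p).hasFDerivAt
  have hm2 : HasFDerivAt (fderiv ℝ m) (fderiv ℝ (fderiv ℝ m) 0) ((0 : Rd d), (0 : Rd d)) :=
    ((hmc.fderiv_right (m := (⊤ : ℕ∞)) (by simp)).differentiable (by simp) _).hasFDerivAt
  have hsymm : ∀ v w, fderiv ℝ (fderiv ℝ m) 0 v w = fderiv ℝ (fderiv ℝ m) 0 w v :=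
    (hmc.contDiffAt (x := 0)).isSymmSndFDerivAt
      (by simp only [minSmoothness_of_isRCLikeNormedField]; exact WithTop.coe_le_coe.2 (le_top (a := (2 : ℕ∞))))
  have hframe : ∀ v p, leftField G.mul v p = fderiv ℝ m (p, 0) (0, v) := by
    intro v p
    have := (hmd (p, 0)).comp (0 : Rd d) (hasFDerivAt_prodMk_right (𝕜 := ℝ) p (0 : Rd d))
    rw [leftField, show G.mul p = m ∘ (fun x => (p, x)) from rfl, this.fderiv]
    simp
  have hright : ∀ v y, fderiv ℝ (fun z => G.mul z y) 0 v = fderiv ℝ m (0, y) (v, 0) := by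
    intro v y
    have := (hmd (0, y)).comp (0 : Rd d) (hasFDerivAt_prodMk_left (𝕜 := ℝ) (0 : Rd d) y)
    rw [show (fun z => G.mul z y) = m ∘ (fun x => (x, y)) from rfl, this.fderiv]
    simp
  have hleft' : ∀ v x, fderiv ℝ (leftField G.mul v) 0 x =
      fderiv ℝ (fderiv ℝ m) 0 (x, 0) (0, v) := by
    intro v x
    have h1 := HasFDerivAt.comp (g := fderiv ℝ m) (f := fun e => (e, (0 : Rd d))) (0 : Rd d) hm2
      (hasFDerivAt_prodMk_left (𝕜 := ℝ) (0 : Rd d) (0 : Rd d))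
    have h2 := h1.clm_apply (hasFDerivAt_const ((0 : Rd d), v) (0 : Rd d))
    rw [show leftField G.mul v = fun p => fderiv ℝ m (p, 0) (0, v) from funext (hframe v)]
    erw [h2.fderiv]
    simp
  have hline : HasDerivAt (fun s : ℝ => s • x) x 0 := by
    simpa using (hasDerivAt_id (0 : ℝ)).smul_const x
  have hco : HasDerivAt (fun s : ℝ => G.coframe (s • x)) (fderiv ℝ G.coframe 0 x) 0 := by
    have h : HasFDerivAt G.coframe (fderiv ℝ G.coframe 0) ((0 : ℝ) • x) := by
      rw [zero_smul]; exact (G.contDiff_coframe.differentiable (by simp) 0).hasFDerivAt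
    exact h.comp_hasDerivAt (0 : ℝ) hline
  have hfr : HasDerivAt (fun s : ℝ => G.frame (s • x)) (fderiv ℝ G.frame 0 x) 0 := by
    have h : HasFDerivAt G.frame (fderiv ℝ G.frame 0) ((0 : ℝ) • x) := by
      rw [zero_smul]; exact (G.contDiff_frame.differentiable (by simp) 0).hasFDerivAt
    exact h.comp_hasDerivAt (0 : ℝ) hline
  have hri : ContDiff ℝ (⊤ : ℕ∞) (fun y => fderiv ℝ (fun z => G.mul z y) (0 : Rd d)) :=
    ContDiff.fderiv (f := fun y z => G.mul z y) (m := (⊤ : ℕ∞))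
      (G.contDiff_mul.comp (contDiff_snd.prodMk contDiff_fst)) contDiff_const (by simp)
  have hR : HasDerivAt (fun s : ℝ => fderiv ℝ (fun z => G.mul z (s • x)) (0 : Rd d))
      (fderiv ℝ (fun y => fderiv ℝ (fun z => G.mul z y) (0 : Rd d)) 0 x) 0 := by
    have h : HasFDerivAt (fun y => fderiv ℝ (fun z => G.mul z y) (0 : Rd d))
        (fderiv ℝ (fun y => fderiv ℝ (fun z => G.mul z y) (0 : Rd d)) 0) ((0 : ℝ) • x) := by
      rw [zero_smul]; exact (hri.differentiable (by simp) 0).hasFDerivAt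
    exact h.comp_hasDerivAt (0 : ℝ) hline
  have hrid : fderiv ℝ (fun z => G.mul z (0 : Rd d)) 0 = ContinuousLinearMap.id ℝ _ := by
    rw [show (fun z => G.mul z (0 : Rd d)) = id from funext G.mul_zero, fderiv_id]
  have hinv : fderiv ℝ G.coframe 0 x + fderiv ℝ G.frame 0 x = 0 := by
    have h1 := hco.clm_comp hfr
    have h2 : HasDerivAt (fun _ : ℝ => ContinuousLinearMap.id ℝ (Rd d)) 0 0 :=
      hasDerivAt_const _ _
    simp only [coframe_comp_frame] at h1
    have := h1.unique h2
    simpa [frame_zero, coframe_zero] using this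
  have hfr' : ∀ v, fderiv ℝ G.frame 0 x v = fderiv ℝ (leftField G.mul v) 0 x := by
    intro v
    have h := (G.contDiff_frame.differentiable (by simp) 0).hasFDerivAt.clm_apply
      (hasFDerivAt_const v (0 : Rd d))
    rw [show leftField G.mul v = fun p => G.frame p v from rfl, h.fderiv]
    simp
  have hri' : ∀ v, fderiv ℝ (fun y => fderiv ℝ (fun z => G.mul z y) (0 : Rd d)) 0 x v =
      fderiv ℝ (leftField G.mul x) 0 v := by
    intro v
    have h := (hri.differentiable (by simp) 0).hasFDerivAt.clm_apply
      (hasFDerivAt_const v (0 : Rd d))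
    have h1 := HasFDerivAt.comp (g := fderiv ℝ m) (f := fun e => ((0 : Rd d), e)) (0 : Rd d) hm2
      (hasFDerivAt_prodMk_right (𝕜 := ℝ) (0 : Rd d) (0 : Rd d))
    have h2 := h1.clm_apply (hasFDerivAt_const (v, (0 : Rd d)) (0 : Rd d))
    have h3 : (fun y => fderiv ℝ (fun z => G.mul z y) (0 : Rd d) v) =
      fun y => fderiv ℝ m (0, y) (v, 0) := funext (hright v)
    rw [h3] at h
    have h4 := congrArg (fun L => L x) (h.unique h2)
    rw [hleft', hsymm]
    simpa using h4
  refine ⟨_, hco.clm_comp hR, fun v => ?_⟩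
  have h5 : fderiv ℝ G.coframe 0 x v = -fderiv ℝ G.frame 0 x v := by
    have := congrArg (fun L => L v) hinv
    simp only [add_apply, zero_apply] at this
    exact eq_neg_of_add_eq_zero_left this
  simp only [zero_smul, hrid, coframe_zero, ContinuousLinearMap.comp_id,
    ContinuousLinearMap.id_comp, add_apply, h5, hri', hfr', algBracket,
    VectorField.lieBracket, leftField_zero]
  abel

lemma pow_eq_zero_of_apply_eq_neg_algBracket {x : Rd d} {D : Rd d →L[ℝ] Rd d}
    (hD : ∀ v, D v = -algBracket G.mul x v) : ∃ r, D ^ (r + 1) = 0 := by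
  obtain ⟨r, hr⟩ := G.nilpotent
  have h : ∀ n v, (D ^ n) v ∈ lowerSeries G.mul n := by
    intro n
    induction n with
    | zero => intro v; exact Submodule.mem_top
    | succ n ih =>
      intro v
      rw [pow_succ', mul_apply_eq_comp, hD]
      exact Submodule.neg_mem _ (Submodule.subset_span ⟨x, Submodule.mem_top, _, ih v, rfl⟩)
  refine ⟨r, ?_⟩
  have h0 : D ^ r = 0 := by
    ext1 v
    have := h r v
    rw [hr, Submodule.mem_bot] at this
    simpa using this
  rw [pow_succ, h0, MulZeroClass.zero_mul]

lemma hasDerivAt_dexp_zero (x : Rd d) : HasDerivAt (G.dexp x) 1 0 := by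
  have hc : HasDerivAt (fun s : ℝ => G.coframe (s • x)) (fderiv ℝ G.coframe ((0 : ℝ) • x) x) 0 :=
    (G.contDiff_coframe.differentiable (by simp) _).hasFDerivAt.comp_hasDerivAt (0 : ℝ)
      (by simpa using (hasDerivAt_id (0 : ℝ)).smul_const x)
  have h := (hasDerivAt_id (0 : ℝ)).fun_smul hc
  refine h.congr_deriv ?_
  ext1 v
  simp [coframe_zero]

/-- The function `t ↦ dexp x t` solves `Y' = 1 + D Y`, `Y 0 = 0` with `D = -ad x` nilpotent. Hence
`coframe x`, its value at `1`, is `1 + D Q` with `D Q` nilpotent, and has determinant one. -/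
lemma det_coframe (x : Rd d) : (G.coframe x).det = 1 := by
  obtain ⟨D, hD, hDv⟩ := G.hasDerivAt_adNeg x
  obtain ⟨r, hr⟩ := G.pow_eq_zero_of_apply_eq_neg_algBracket hDv
  have hY : ∀ t, HasDerivAt (G.dexp x) (1 + D * G.dexp x t) t := by
    intro t
    have h1 : HasDerivAt (fun s => (G.adNeg x s).comp (G.dexp x t) + G.dexp x s)
        (D.comp (G.dexp x t) + 1) 0 := by
      have := (hD.clm_comp (hasDerivAt_const (0 : ℝ) (G.dexp x t))).add
        (G.hasDerivAt_dexp_zero x)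
      simp only [ContinuousLinearMap.comp_zero, add_zero] at this
      exact this
    have h2 : HasDerivAt (fun s => G.dexp x (t + s)) (D.comp (G.dexp x t) + 1) 0 :=
      h1.congr_of_eventuallyEq (Filter.Eventually.of_forall fun s => G.dexp_add x t s)
    have h3 := HasDerivAt.comp_sub_const t t (f := fun s => G.dexp x (t + s)) (by simpa using h2)
    have h4 : (fun s => G.dexp x (t + (s - t))) = G.dexp x := by
      funext s; congr 1; ring
    rw [h4, add_comm] at h3
    exact h3
  obtain ⟨Q, hcomm, h2⟩ := exists_eq_one_add_mul_of_hasDerivAt hr hY (by ext1 v; simp [dexp])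
  have h3 : G.dexp x 1 = G.coframe x := by simp [dexp]
  rw [h3] at h2
  have hnil : IsNilpotent (D * Q) := hcomm.isNilpotent_mul_right ⟨r + 1, hr⟩
  obtain ⟨n, hn⟩ := hnil
  rw [h2, ContinuousLinearMap.det]
  have h4 : ((1 + D * Q : Rd d →L[ℝ] Rd d) : Rd d →ₗ[ℝ] Rd d) =
      1 + ((D * Q : Rd d →L[ℝ] Rd d) : Rd d →ₗ[ℝ] Rd d) := rfl
  rw [h4]
  refine LinearMap.det_one_add_of_isNilpotent ⟨n, ?_⟩
  have := congrArg (fun L : Rd d →L[ℝ] Rd d => (L : Rd d →ₗ[ℝ] Rd d)) hn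
  simpa using this

lemma det_frame (x : Rd d) : (G.frame x).det = 1 := by
  have h := congrArg ContinuousLinearMap.det (G.coframe_comp_frame x)
  rw [ContinuousLinearMap.det_comp', G.det_coframe, one_mul] at h
  rw [h]
  exact LinearMap.det_id

lemma det_fderiv_mul_left (g x : Rd d) : (fderiv ℝ (G.mul g) x).det = 1 := by
  have h := congrArg ContinuousLinearMap.det (G.fderiv_mul_left_comp_frame g x)
  rwa [ContinuousLinearMap.det_comp', G.det_frame, G.det_frame, mul_one] at h

/-- Lebesgue measure is invariant under left translations. -/
lemma measurePreserving_mul_left (g : Rd d) : MeasurePreserving (G.mul g) := by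
  refine ⟨(G.continuous_mul_left g).measurable, Measure.ext fun s hs => ?_⟩
  rw [Measure.map_apply (G.continuous_mul_left g).measurable hs]
  have hpre : G.mul g ⁻¹' s = G.mul (-g) '' s := by
    ext y
    constructor
    · intro hy
      exact ⟨_, hy, G.neg_mul_cancel_left g y⟩
    · rintro ⟨z, hz, rfl⟩
      change G.mul g (G.mul (-g) z) ∈ s
      rwa [G.mul_neg_cancel_left]
  rw [hpre, ← lintegral_abs_det_fderiv_eq_addHaar_image volume hs
    (fun x _ => (G.differentiable_mul_left (-g) x).hasFDerivAt.hasFDerivWithinAt)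
    ((G.leftHomeo (-g)).injective.injOn)]
  simp [det_fderiv_mul_left]

end NilpotentGroup

/-! ### Euclidean divergence and integration by parts -/

/-- The Euclidean divergence `∑ ∂_i U_i`. -/
noncomputable def euclideanDiv {d : ℕ} (U : Rd d → Rd d) (p : Rd d) : ℝ :=
  ∑ i : Fin d, fderiv ℝ (fun y => U y i) p (EuclideanSpace.single i 1)

section Euclidean

variable {d : ℕ} {W : Rd d → Rd d}

lemma contDiff_coord (hW : ContDiff ℝ 1 W) (i : Fin d) : ContDiff ℝ 1 (fun y => W y i) :=
  (EuclideanSpace.proj (𝕜 := ℝ) i).contDiff.comp hW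

lemma HasCompactSupport.coord (hc : HasCompactSupport W) (i : Fin d) :
    HasCompactSupport (fun y => W y i) :=
  hc.comp_left (g := fun v : Rd d => v i) rfl

lemma continuous_fderiv_coord (hW : ContDiff ℝ 1 W) (i : Fin d) (v : Rd d) :
    Continuous (fun p => fderiv ℝ (fun y => W y i) p v) :=
  ((contDiff_coord hW i).continuous_fderiv (by simp)).clm_apply continuous_const

lemma continuous_euclideanDiv (hW : ContDiff ℝ 1 W) : Continuous (euclideanDiv W) :=
  continuous_finsetSum _ fun i _ => continuous_fderiv_coord hW i _

lemma hasCompactSupport_fderiv_coord (hc : HasCompactSupport W) (i : Fin d) (v : Rd d) :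
    HasCompactSupport (fun p => fderiv ℝ (fun y => W y i) p v) :=
  (hc.coord i).fderiv_apply ℝ v

lemma hasCompactSupport_euclideanDiv (hc : HasCompactSupport W) :
    HasCompactSupport (euclideanDiv W) := by
  refine HasCompactSupport.of_support_subset_isCompact hc fun p hp => ?_
  by_contra hcon
  refine hp (Finset.sum_eq_zero fun i _ => ?_)
  have h1 : (fun y => W y i) =ᶠ[nhds p] fun _ => 0 := by
    filter_upwards [notMem_tsupport_iff_eventuallyEq.mp hcon] with y hy
    simp [hy]
  rw [h1.fderiv_eq]
  simp

lemma integrable_euclideanDiv (hW : ContDiff ℝ 1 W) (hc : HasCompactSupport W) :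
    Integrable (euclideanDiv W) :=
  (continuous_euclideanDiv hW).integrable_of_hasCompactSupport (hasCompactSupport_euclideanDiv hc)

lemma integral_mul_euclideanDiv {φ : Rd d → ℝ} (hφ : ContDiff ℝ 1 φ) (hW : ContDiff ℝ 1 W)
    (hc : HasCompactSupport W) :
    ∫ x, φ x * euclideanDiv W x = -∫ x, fderiv ℝ φ x (W x) := by
  have hφ' : ∀ v, Continuous fun x => fderiv ℝ φ x v := fun v =>
    (hφ.continuous_fderiv (by simp)).clm_apply continuous_const
  have hI1 : ∀ i : Fin d, Integrable fun x =>
      φ x * fderiv ℝ (fun y => W y i) x (EuclideanSpace.single i 1) := fun i =>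
    (hφ.continuous.mul (continuous_fderiv_coord hW i _)).integrable_of_hasCompactSupport
      (hasCompactSupport_fderiv_coord hc i _).mul_left
  have hI2 : ∀ i : Fin d, Integrable fun x =>
      fderiv ℝ φ x (EuclideanSpace.single i 1) * W x i := fun i =>
    ((hφ' _).mul (contDiff_coord hW i).continuous).integrable_of_hasCompactSupport
      (hc.coord i).mul_left
  have hI3 : ∀ i : Fin d, Integrable fun x => φ x * W x i := fun i =>
    (hφ.continuous.mul (contDiff_coord hW i).continuous).integrable_of_hasCompactSupport
      (hc.coord i).mul_left
  have h1 : ∀ x, fderiv ℝ φ x (W x) =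
      ∑ i : Fin d, fderiv ℝ φ x (EuclideanSpace.single i 1) * W x i := by
    intro x
    have h := (EuclideanSpace.basisFun (Fin d) ℝ).sum_repr (W x)
    conv_lhs => rw [← h]
    simp [map_sum, mul_comm]
  simp only [h1, euclideanDiv, Finset.mul_sum]
  rw [integral_finsetSum _ fun i _ => hI1 i, integral_finsetSum _ fun i _ => hI2 i,
    ← Finset.sum_neg_distrib]
  refine Finset.sum_congr rfl fun i _ => ?_
  exact integral_mul_fderiv_eq_neg_fderiv_mul_of_integrable (hI2 i) (hI1 i) (hI3 i)
    (fun x _ => hφ.differentiable (by simp) x)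
    (fun x _ => (contDiff_coord hW i).differentiable (by simp) x)

end Euclidean

/-! ### Push-forward of fields by left translations -/

namespace NilpotentGroup

variable {d : ℕ} (G : NilpotentGroup d)

/-- The push-forward of a vector field under a left translation. -/
noncomputable def push (g : Rd d) (W : Rd d → Rd d) (x : Rd d) : Rd d :=
  fderiv ℝ (G.mul g) (G.mul (-g) x) (W (G.mul (-g) x))

lemma contDiff_push (g : Rd d) {W : Rd d → Rd d} (hW : ContDiff ℝ 1 W) :
    ContDiff ℝ 1 (G.push g W) := by
  have h1 : ContDiff ℝ 1 (G.mul (-g)) := (G.contDiff_mul_left (-g)).of_le (by simp)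
  have h2 : ContDiff ℝ 1 (fderiv ℝ (G.mul g)) := 
    ((G.contDiff_mul_left g).fderiv_right (m := (⊤ : ℕ∞)) (by simp)).of_le (by simp)
  exact (h2.comp h1).clm_apply (hW.comp h1)

lemma hasCompactSupport_push (g : Rd d) {W : Rd d → Rd d} (hc : HasCompactSupport W) :
    HasCompactSupport (G.push g W) := by
  have h := hc.comp_homeomorph (G.leftHomeo (-g))
  refine h.mono fun x hx => ?_
  contrapose! hx
  have : W (G.mul (-g) x) = 0 := by simpa [leftHomeo] using hx
  simp [push, this]

lemma measurableEmbedding_mul_left (g : Rd d) : MeasurableEmbedding (G.mul g) :=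
  (G.leftHomeo g).measurableEmbedding

/-- Left translations preserve the divergence. -/
lemma euclideanDiv_push_ae (g : Rd d) {W : Rd d → Rd d} (hW : ContDiff ℝ 1 W)
    (hc : HasCompactSupport W) :
    ∀ᵐ x, euclideanDiv (G.push g W) x = euclideanDiv W (G.mul (-g) x) := by
  -- The identity is tested weakly: after integration by parts only the chain rule and invariance of
  -- the measure are needed. Equality almost everywhere is enough under integrals.
  refine ae_eq_of_integral_contDiff_smul_eq
    (continuous_euclideanDiv (G.contDiff_push g hW)).locallyIntegrable
    ((continuous_euclideanDiv hW).comp (G.continuous_mul_left _)).locallyIntegrable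
    fun φ hφ _ => ?_
  have hφ1 : ContDiff ℝ 1 φ := hφ.of_le (by simp)
  have hmp := fun f : Rd d → ℝ =>
    (G.measurePreserving_mul_left g).integral_comp (G.measurableEmbedding_mul_left g) f
  simp only [smul_eq_mul]
  rw [integral_mul_euclideanDiv hφ1 (G.contDiff_push g hW) (G.hasCompactSupport_push g hc),
    ← hmp (fun x => fderiv ℝ φ x (G.push g W x)),
    ← hmp (fun x => φ x * euclideanDiv W (G.mul (-g) x))]
  simp only [push, G.neg_mul_cancel_left]
  have h := integral_mul_euclideanDiv (φ := φ ∘ G.mul g)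
    (hφ1.comp ((G.contDiff_mul_left g).of_le (by simp))) hW hc
  simp only [Function.comp_apply] at h
  rw [h]
  congr 2
  funext x
  rw [fderiv_comp x (hφ1.differentiable (by simp) _) (G.differentiable_mul_left g x)]
  rfl

lemma setIntegral_euclideanDiv_preimage (g : Rd d) {W : Rd d → Rd d} (hW : ContDiff ℝ 1 W)
    (hc : HasCompactSupport W) (E : Set (Rd d)) :
    ∫ x in G.mul g ⁻¹' E, euclideanDiv W x = ∫ x in E, euclideanDiv (G.push g W) x := by
  have h := (G.measurePreserving_mul_left g).setIntegral_preimage_emb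
    (G.measurableEmbedding_mul_left g) (fun x => euclideanDiv W (G.mul (-g) x)) E
  simp only [G.neg_mul_cancel_left] at h
  rw [integral_congr_ae (ae_restrict_of_ae (G.euclideanDiv_push_ae g hW hc)), h]

end NilpotentGroup

/-! ### Riemannian divergence, admissible fields and invariance of perimeter -/

namespace SubFinslerGroup

variable {d k : ℕ} (S : SubFinslerGroup d k)

/-- The Gram matrix at `p` is `Aᵀ M A`, where `M` is the Gram matrix at the identity and `A`, the
matrix of `coframe p`, has determinant one. -/
lemma exists_density_eq : ∃ c : ℝ, c ≠ 0 ∧ ∀ p, S.density p = c := by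
  set b := (EuclideanSpace.basisFun (Fin d) ℝ).toBasis with hb
  set M := LinearMap.BilinForm.toMatrix b S.g₀ with hM
  have hpos : M.PosDef := by
    refine Matrix.PosDef.of_dotProduct_mulVec_pos ?_ fun x hx => ?_
    · ext i j
      simp [hM, LinearMap.BilinForm.toMatrix_apply, S.g₀_symm]
    · have hx' : b.equivFun.symm x ≠ 0 := (map_ne_zero_iff _ b.equivFun.symm.injective).2 hx
      have := S.g₀_pos _ hx'
      rw [hM, star_trivial, LinearMap.BilinForm.dotProduct_toMatrix_mulVec]
      exact this
  refine ⟨Real.sqrt M.det, (Real.sqrt_pos.2 hpos.det_pos).ne', fun p => ?_⟩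
  have h1 : (Matrix.of fun i j : Fin d =>
      S.metric p (EuclideanSpace.single i 1) (EuclideanSpace.single j 1)) =
      LinearMap.BilinForm.toMatrix b (S.g₀.comp (S.coframe p : Rd d →ₗ[ℝ] Rd d)
        (S.coframe p : Rd d →ₗ[ℝ] Rd d)) := by
    ext i j
    simp [hb, LinearMap.BilinForm.toMatrix_apply, metric, NilpotentGroup.coframe]
  have h2 : LinearMap.det (S.coframe p : Rd d →ₗ[ℝ] Rd d) = 1 := S.det_coframe p
  rw [density, h1, LinearMap.BilinForm.toMatrix_comp b b, Matrix.det_mul, Matrix.det_mul,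
    Matrix.det_transpose, LinearMap.det_toMatrix, h2, one_mul, mul_one]

lemma divergence_eq {U : Rd d → Rd d} (hU : ContDiff ℝ 1 U) : S.divergence U = euclideanDiv U := by
  obtain ⟨c, hc, hd⟩ := S.exists_density_eq
  funext p
  simp only [divergence, euclideanDiv, hd, Finset.mul_sum]
  refine Finset.sum_congr rfl fun i _ => ?_
  rw [fderiv_const_mul ((contDiff_coord hU i).differentiable (by simp) p)]
  simp [hc]

variable {S}

lemma Admissible.zero : S.Admissible 0 := by
  refine ⟨contDiff_const, HasCompactSupport.zero, fun p => ⟨0, ?_, by simp⟩⟩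
  simp [leftField]

lemma Admissible.push {U : Rd d → Rd d} (hU : S.Admissible U) (g : Rd d) :
    S.Admissible (S.push g U) := by
  refine ⟨S.contDiff_push g hU.1, S.hasCompactSupport_push g hU.2.1, fun p => ?_⟩
  obtain ⟨v, hv, hv1⟩ := hU.2.2 (S.mul (-g) p)
  refine ⟨v, ?_, hv1⟩
  have h := congrArg (fun L => L (v : Rd d)) (S.fderiv_mul_left_comp_frame g (S.mul (-g) p))
  rw [S.mul_neg_cancel_left] at h
  rw [NilpotentGroup.push, hv]
  exact h

/-- Pointwise convex combinations of admissible fields with `C^1` weights are admissible. -/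
lemma Admissible.combine {U V : Rd d → Rd d} (hU : S.Admissible U) (hV : S.Admissible V)
    {θ : Rd d → ℝ} (hθ : ContDiff ℝ 1 θ) (h0 : ∀ x, 0 ≤ θ x) (h1 : ∀ x, θ x ≤ 1) :
    S.Admissible (fun x => θ x • U x + (1 - θ x) • V x) := by
  have hs1 : HasCompactSupport (fun x => θ x • U x) := hU.2.1.smul_left (f := θ)
  have hs2 : HasCompactSupport (fun x => (1 - θ x) • V x) :=
    hV.2.1.smul_left (f := fun x => 1 - θ x)
  have hc : ContDiff ℝ 1 (fun x => θ x • U x + (1 - θ x) • V x) :=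
    (hθ.smul hU.1).add ((contDiff_const.sub hθ).smul hV.1)
  refine ⟨hc, hs1.add hs2, fun p => ?_⟩
  obtain ⟨u, hu, hu1⟩ := hU.2.2 p
  obtain ⟨v, hv, hv1⟩ := hV.2.2 p
  refine ⟨θ p • u + (1 - θ p) • v, ?_, ?_⟩
  · beta_reduce
    rw [hu, hv]
    exact (((fderiv ℝ (S.mul p) 0).map_add _ _).trans (congrArg₂ (· + ·)
      ((fderiv ℝ (S.mul p) 0).map_smul _ _) ((fderiv ℝ (S.mul p) 0).map_smul _ _))).symm
  · have habs : Absorbent ℝ S.K :=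
      absorbent_nhds_zero (mem_interior_iff_mem_nhds.mp S.zero_mem_interior_K)
    have h2 : 0 ≤ 1 - θ p := sub_nonneg.2 (h1 p)
    calc gauge S.K (θ p • u + (1 - θ p) • v)
        ≤ gauge S.K (θ p • u) + gauge S.K ((1 - θ p) • v) := gauge_add_le S.convex_K habs _ _
      _ = θ p * gauge S.K u + (1 - θ p) * gauge S.K v := by
          rw [gauge_smul_of_nonneg (h0 p), gauge_smul_of_nonneg h2, smul_eq_mul, smul_eq_mul]
      _ ≤ θ p * 1 + (1 - θ p) * 1 := by gcongr; exact h0 p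
      _ = 1 := by ring

lemma perimeter_le_iff {E : Set (Rd d)} {c : ENNReal} : S.perimeter E ≤ c ↔
    ∀ U, S.Admissible U → ENNReal.ofReal (∫ x in E, euclideanDiv U x) ≤ c := by
  rw [perimeter, iSup₂_le_iff]
  refine forall₂_congr fun U hU => ?_
  rw [S.divergence_eq hU.1]

lemma ofReal_setIntegral_le_perimeter {U : Rd d → Rd d} (hU : S.Admissible U) (E : Set (Rd d)) :
    ENNReal.ofReal (∫ x in E, euclideanDiv U x) ≤ S.perimeter E :=
  perimeter_le_iff.1 le_rfl U hU

lemma setIntegral_le_perimeter_toReal {U : Rd d → Rd d} (hU : S.Admissible U) {E : Set (Rd d)}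
    (hE : S.perimeter E < ⊤) : ∫ x in E, euclideanDiv U x ≤ (S.perimeter E).toReal :=
  (ENNReal.ofReal_le_iff_le_toReal hE.ne).1 (ofReal_setIntegral_le_perimeter hU E)

lemma perimeter_congr_ae {E E' : Set (Rd d)} (h : E =ᵐ[volume] E') :
    S.perimeter E = S.perimeter E' := by
  simp only [perimeter, Measure.restrict_congr_set h]

lemma perimeter_preimage_mul_left_le (g : Rd d) (E : Set (Rd d)) :
    S.perimeter (S.mul g ⁻¹' E) ≤ S.perimeter E := by
  rw [perimeter_le_iff]
  intro U hU
  rw [S.setIntegral_euclideanDiv_preimage g hU.1 hU.2.1]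
  exact ofReal_setIntegral_le_perimeter (hU.push g) E

end SubFinslerGroup

/-! ### Mollification by averaging left translates -/

namespace NilpotentGroup

open Filter Topology

variable {d : ℕ} (G : NilpotentGroup d)

/-- Left translation as a continuous map. -/
def leftMap (g : Rd d) : C(Rd d, Rd d) := ⟨G.mul g, G.continuous_mul_left g⟩

lemma continuous_leftMap : Continuous G.leftMap :=
  ContinuousMap.continuous_of_continuous_uncurry G.leftMap (by exact G.continuous_mul)

lemma tendsto_volume_symmDiff_of_continuous {F : Rd d → C(Rd d, Rd d)} (hc : Continuous F)
    (hmp : ∀ g, MeasurePreserving (F g) volume volume) {E : Set (Rd d)} (hE : MeasurableSet E)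
    (hfin : volume E < ⊤) (g₀ : Rd d) :
    Tendsto (fun g => volume (symmDiff (F g ⁻¹' E) (F g₀ ⁻¹' E))) (𝓝 g₀) (𝓝 0) :=
  tendsto_measure_symmDiff_preimage_nhds_zero (hc.tendsto g₀) (Eventually.of_forall hmp) (hmp g₀)
    hE.nullMeasurableSet hfin.ne

/-- Translations act continuously on sets of finite measure. -/
lemma tendsto_volume_symmDiff_preimage {E : Set (Rd d)} (hE : MeasurableSet E)
    (hfin : volume E < ⊤) (g₀ : Rd d) :
    Tendsto (fun g => volume (symmDiff (G.mul g ⁻¹' E) (G.mul g₀ ⁻¹' E))) (𝓝 g₀) (𝓝 0) := by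
  have hmp : ∀ g, MeasurePreserving (G.leftMap g) volume volume := fun g =>
    G.measurePreserving_mul_left g
  exact tendsto_volume_symmDiff_of_continuous G.continuous_leftMap hmp hE hfin g₀

/-- The average of the left translates of the indicator function of `E` with weight `η`. -/
noncomputable def mollify (η : Rd d → ℝ) (E : Set (Rd d)) (x : Rd d) : ℝ :=
  ∫ z, E.indicator 1 z * η (G.mul x (-z))

lemma contDiff_mollify {η : Rd d → ℝ} (hη : ContDiff ℝ 1 η) (hc : HasCompactSupport η)
    {E : Set (Rd d)} (hE : MeasurableSet E) :
    ContDiff ℝ 1 (G.mollify η E) := by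
  rw [contDiff_iff_contDiffAt]
  intro x₀
  set s : Set (Rd d) := Metric.ball 0 (‖x₀‖ + 1) with hs
  set k : Set (Rd d) := (fun p : Rd d × Rd d => G.mul (-p.1) p.2) ''
    (Metric.closedBall 0 (‖x₀‖ + 1) ×ˢ tsupport η) with hk
  have hkc : IsCompact k :=
    ((isCompact_closedBall _ _).prod hc).image
      (G.continuous_mul.comp (continuous_fst.neg.prodMk continuous_snd))
  have hf : LocallyIntegrable (E.indicator (1 : Rd d → ℝ)) :=
    (locallyIntegrable_const (1 : ℝ)).indicator hE
  have hzero : ∀ p, ∀ x, p ∈ s → x ∉ k → η (G.mul p x) = 0 := by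
    intro p x hp hx
    by_contra hne
    refine hx ⟨(p, G.mul p x), ⟨Metric.ball_subset_closedBall hp, ?_⟩, ?_⟩
    · exact subset_tsupport _ hne
    · exact G.neg_mul_cancel_left p x
  have hg : ContDiffOn ℝ ((1 : ℕ∞) : WithTop ℕ∞)
      (Function.HasUncurry.uncurry fun p x => η (G.mul p x)) (s ×ˢ Set.univ) :=
    (hη.comp (G.contDiff_mul.of_le (by simp))).contDiffOn
  have h := contDiffOn_convolution_right_with_param_comp (ContinuousLinearMap.mul ℝ ℝ)
    (v := fun _ : Rd d => (0 : Rd d)) (μ := volume) contDiffOn_const Metric.isOpen_ball hkc hzero hf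
    hg
  have hx₀ : x₀ ∈ s := by simp [hs]
  have h2 := h.contDiffAt (Metric.isOpen_ball.mem_nhds hx₀)
  -- The group average is a Euclidean convolution evaluated at `0`, with `x` a parameter of the
  -- kernel; differentiability in parameters then applies.
  have h3 : (fun x => convolution (E.indicator (1 : Rd d → ℝ)) (fun y => η (G.mul x y))
      (ContinuousLinearMap.mul ℝ ℝ) volume 0) = G.mollify η E := by
    funext x
    simp [convolution, mollify]
  rw [← h3]
  exact h2

/-- Substitute `y = x · (-z)`, which preserves Lebesgue measure. In the definition `x` enters only
through `η`, which gives smoothness; this form shows an average of translates, which gives the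
perimeter bound. -/
lemma mollify_eq (η : Rd d → ℝ) (E : Set (Rd d)) (x : Rd d) :
    G.mollify η E x = ∫ y, η y * (G.mul (-y) ⁻¹' E).indicator 1 x := by
  have hmp : MeasurePreserving (fun z => G.mul x (-z)) :=
    (G.measurePreserving_mul_left x).comp (Measure.measurePreserving_neg volume)
  have hme : MeasurableEmbedding (fun z => G.mul x (-z)) :=
    (G.measurableEmbedding_mul_left x).comp (MeasurableEquiv.neg _).measurableEmbedding
  rw [← hmp.integral_comp hme, mollify]
  refine integral_congr_ae (Eventually.of_forall fun z => ?_)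
  have : G.mul (-(G.mul x (-z))) x = z := by
    rw [G.neg_mul_rev, neg_neg, G.mul_assoc, G.neg_mul_self, G.mul_zero]
  have hiff : x ∈ G.mul (-(G.mul x (-z))) ⁻¹' E ↔ z ∈ E := by rw [Set.mem_preimage, this]
  by_cases hz : z ∈ E
  · simp [hz, Set.indicator_of_mem (hiff.2 hz)]
  · simp [hz, Set.indicator_of_notMem (mt hiff.1 hz)]

lemma measurable_indicator_preimage {E : Set (Rd d)} (hE : MeasurableSet E) :
    Measurable fun p : Rd d × Rd d => (G.mul (-p.2) ⁻¹' E).indicator (1 : Rd d → ℝ) p.1 := by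
  have hm : Measurable fun p : Rd d × Rd d => G.mul (-p.2) p.1 :=
    (G.continuous_mul.comp (continuous_snd.neg.prodMk continuous_fst)).measurable
  exact (measurable_const (a := (1 : ℝ))).indicator (hm hE)

lemma abs_indicator_one_le {E : Set (Rd d)} (x : Rd d) :
    |E.indicator (1 : Rd d → ℝ) x| ≤ 1 := by
  by_cases h : x ∈ E <;> simp [h]

lemma integral_mollify_mul {η : Rd d → ℝ} (hη : Integrable η) {E : Set (Rd d)}
    (hE : MeasurableSet E) {φ : Rd d → ℝ} (hφ : Integrable φ) :
    ∫ x, G.mollify η E x * φ x = ∫ y, η y * ∫ x in G.mul (-y) ⁻¹' E, φ x := by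
  have hint : Integrable (fun p : Rd d × Rd d =>
      (G.mul (-p.2) ⁻¹' E).indicator (1 : Rd d → ℝ) p.1 * (φ p.1 * η p.2))
      (volume.prod volume) := by
    refine (hφ.mul_prod hη).bdd_mul (c := 1)
      (G.measurable_indicator_preimage hE).aestronglyMeasurable
      (Eventually.of_forall fun p => ?_)
    exact abs_indicator_one_le _
  simp only [mollify_eq, ← integral_mul_const]
  have h1 := integral_integral_swap (f := fun x y : Rd d =>
    (G.mul (-y) ⁻¹' E).indicator (1 : Rd d → ℝ) x * (φ x * η y)) hint
  have h2 : ∀ y, η y * ∫ x in G.mul (-y) ⁻¹' E, φ x = ∫ x,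
      (G.mul (-y) ⁻¹' E).indicator (1 : Rd d → ℝ) x * (φ x * η y) := by
    intro y
    rw [← integral_indicator (G.continuous_mul_left (-y) |>.measurable hE),
      ← integral_const_mul]
    refine integral_congr_ae (Eventually.of_forall fun x => ?_)
    by_cases h : x ∈ G.mul (-y) ⁻¹' E
    · simp [Set.indicator_of_mem h, mul_comm]
    · simp [Set.indicator_of_notMem h]
  simp only [h2]
  rw [← h1]
  refine integral_congr_ae (Eventually.of_forall fun x => ?_)
  refine integral_congr_ae (Eventually.of_forall fun y => ?_)
  simp only []
  ring

/-- Since `η` is a probability density, Tonelli bounds the `L¹` distance by the `η`-average of the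
measures of the symmetric differences. -/
lemma lintegral_enorm_mollify_sub_le {η : Rd d → ℝ} (hη : Continuous η) (hc : HasCompactSupport η)
    (h0 : ∀ y, 0 ≤ η y) (h1 : ∫ y, η y = 1) {E : Set (Rd d)} (hE : MeasurableSet E)
    {ε : ENNReal} (hε : ∀ y, η y ≠ 0 → volume (symmDiff (G.mul (-y) ⁻¹' E) E) ≤ ε) :
    ∫⁻ x, ‖G.mollify η E x - E.indicator 1 x‖ₑ ≤ ε := by
  have hηi : Integrable η := hη.integrable_of_hasCompactSupport hc
  have hmE : Measurable (E.indicator (1 : Rd d → ℝ)) := measurable_one.indicator hE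
  have hsec : ∀ x, Measurable fun y => (G.mul (-y) ⁻¹' E).indicator (1 : Rd d → ℝ) x := fun x =>
    (G.measurable_indicator_preimage hE).comp measurable_prodMk_left
  have hpt : ∀ x, ‖G.mollify η E x - E.indicator 1 x‖ₑ ≤
      ∫⁻ y, ‖η y‖ₑ * ‖(G.mul (-y) ⁻¹' E).indicator (1 : Rd d → ℝ) x - E.indicator 1 x‖ₑ := by
    intro x
    have hi1 : Integrable fun y => η y * (G.mul (-y) ⁻¹' E).indicator (1 : Rd d → ℝ) x :=
      hηi.mul_bdd (c := 1) (hsec x).aestronglyMeasurable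
        (Eventually.of_forall fun y => abs_indicator_one_le _)
    have h2 : G.mollify η E x - E.indicator 1 x = ∫ y, η y *
        ((G.mul (-y) ⁻¹' E).indicator (1 : Rd d → ℝ) x - E.indicator 1 x) := by
      simp only [mul_sub]
      rw [integral_sub hi1 (hηi.mul_const _), integral_mul_const, h1, one_mul, mollify_eq]
    rw [h2]
    refine (enorm_integral_le_lintegral_enorm _).trans (le_of_eq ?_)
    simp only [enorm_mul]
  have hmeas : AEMeasurable (Function.uncurry fun x y : Rd d =>
      ‖η y‖ₑ * ‖(G.mul (-y) ⁻¹' E).indicator (1 : Rd d → ℝ) x - E.indicator 1 x‖ₑ)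
      (volume.prod volume) :=
    ((hη.measurable.comp measurable_snd).enorm.mul
      ((G.measurable_indicator_preimage hE).sub (hmE.comp measurable_fst)).enorm).aemeasurable
  calc ∫⁻ x, ‖G.mollify η E x - E.indicator 1 x‖ₑ
      ≤ ∫⁻ x, ∫⁻ y, ‖η y‖ₑ *
          ‖(G.mul (-y) ⁻¹' E).indicator (1 : Rd d → ℝ) x - E.indicator 1 x‖ₑ :=
        lintegral_mono hpt
    _ = ∫⁻ y, ∫⁻ x, ‖η y‖ₑ *
          ‖(G.mul (-y) ⁻¹' E).indicator (1 : Rd d → ℝ) x - E.indicator 1 x‖ₑ :=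
        lintegral_lintegral_swap hmeas
    _ ≤ ∫⁻ y, ‖η y‖ₑ * ε := by
        refine lintegral_mono fun y => ?_
        rw [lintegral_const_mul' _ _ enorm_ne_top]
        rcases eq_or_ne (η y) 0 with hy | hy
        · simp [hy]
        gcongr
        refine le_trans (le_of_eq ?_) (hε y hy)
        have hms : MeasurableSet (symmDiff (G.mul (-y) ⁻¹' E) E) :=
          ((G.continuous_mul_left (-y)).measurable hE).symmDiff hE
        rw [← lintegral_indicator_one hms]
        refine lintegral_congr fun x => ?_
        by_cases hx1 : x ∈ G.mul (-y) ⁻¹' E <;> by_cases hx2 : x ∈ E <;>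
          simp [Set.indicator, Set.mem_symmDiff, hx1, hx2, -Set.mem_preimage]
    _ = ε := by
        rw [lintegral_mul_const _ hη.measurable.enorm]
        have : ∫⁻ y, ‖η y‖ₑ = 1 := by
          rw [← ofReal_integral_norm_eq_lintegral_enorm hηi]
          simp [Real.norm_of_nonneg (h0 _), h1]
        rw [this, one_mul]

end NilpotentGroup

/-! ### Smooth approximation of sets of finite perimeter -/

namespace SubFinslerGroup

open Filter Topology

variable {d k : ℕ} {S : SubFinslerGroup d k}

/-- Sets of finite perimeter are approximated by `C^1` functions without increase of the total
variation. -/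
lemma exists_contDiff_approx {E : Set (Rd d)} (hE : MeasurableSet E) (hfin : volume E < ⊤)
    (hP : S.perimeter E < ⊤) {ε : ℝ} (hε : 0 < ε) :
    ∃ f : Rd d → ℝ, ContDiff ℝ 1 f ∧
      (∀ W, S.Admissible W → ∫ x, f x * euclideanDiv W x ≤ (S.perimeter E).toReal) ∧
      Integrable (fun x => f x - E.indicator 1 x) ∧
      ∫ x, |f x - E.indicator 1 x| ≤ ε := by
  have ht : ∀ᶠ y in 𝓝 (0 : Rd d),
      volume (symmDiff (S.mul (-y) ⁻¹' E) E) ≤ ENNReal.ofReal ε := by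
    have h := S.tendsto_volume_symmDiff_preimage hE hfin (-0)
    have h0 : S.mul (-0) ⁻¹' E = E := by
      ext x; simp [S.zero_mul]
    rw [h0] at h
    exact (h.comp (continuous_neg.tendsto (0 : Rd d))).eventually
      (ge_mem_nhds (by simpa using hε))
  obtain ⟨r, hr, hball⟩ := Metric.eventually_nhds_iff_ball.1 ht
  let b : ContDiffBump (0 : Rd d) := ⟨r / 2, r, by positivity, by linarith⟩
  set η := b.normed volume with hη
  have hηc : HasCompactSupport η := b.hasCompactSupport_normed
  have hηd : ContDiff ℝ 1 η := b.contDiff_normed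
  have h0 : ∀ y, 0 ≤ η y := b.nonneg_normed
  have h1 : ∫ y, η y = 1 := b.integral_normed
  have hηi : Integrable η := hηd.continuous.integrable_of_hasCompactSupport hηc
  have hle := S.lintegral_enorm_mollify_sub_le hηd.continuous hηc h0 h1 hE
    (ε := ENNReal.ofReal ε) fun y hy => hball y (by
      have : y ∈ Function.support η := hy
      rwa [hη, b.support_normed_eq] at this)
  have hd := S.contDiff_mollify hηd hηc hE
  have hint : Integrable (fun x => S.mollify η E x - E.indicator 1 x) :=
    ⟨hd.continuous.aestronglyMeasurable.sub
      (measurable_one.indicator hE).aestronglyMeasurable, lt_of_le_of_lt hle ENNReal.ofReal_lt_top⟩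
  refine ⟨S.mollify η E, hd, fun W hW => ?_, hint, ?_⟩
  · rw [S.integral_mollify_mul hηi hE (integrable_euclideanDiv hW.1 hW.2.1)]
    have hI : ∀ y, ∫ x in S.mul (-y) ⁻¹' E, euclideanDiv W x ≤ (S.perimeter E).toReal := by
      intro y
      rw [S.setIntegral_euclideanDiv_preimage _ hW.1 hW.2.1]
      exact setIntegral_le_perimeter_toReal (hW.push _) hP
    -- If integrability fails, the integral is `0` by convention and the bound still holds.
    by_cases hi : Integrable fun y => η y * ∫ x in S.mul (-y) ⁻¹' E, euclideanDiv W x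
    · calc ∫ y, η y * ∫ x in S.mul (-y) ⁻¹' E, euclideanDiv W x
          ≤ ∫ y, η y * (S.perimeter E).toReal :=
            integral_mono hi (hηi.mul_const _) fun y => mul_le_mul_of_nonneg_left (hI y) (h0 y)
        _ = (S.perimeter E).toReal := by rw [integral_mul_const, h1, one_mul]
    · rw [integral_undef hi]
      exact ENNReal.toReal_nonneg
  · have h2 := ofReal_integral_norm_eq_lintegral_enorm hint
    rw [← h2] at hle
    exact (ENNReal.ofReal_le_ofReal_iff hε.le).1 hle

end SubFinslerGroup

/-! ### A smooth positive part -/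

/-- A smooth approximation of the positive part. -/
noncomputable def smoothPos (δ s : ℝ) : ℝ := (s + Real.sqrt (s ^ 2 + δ ^ 2)) / 2

/-- The derivative of `smoothPos`. -/
noncomputable def smoothStep (δ s : ℝ) : ℝ := (1 + s / Real.sqrt (s ^ 2 + δ ^ 2)) / 2

section SmoothPos

variable {δ : ℝ}

lemma sq_add_sq_pos' (hδ : 0 < δ) (s : ℝ) : 0 < s ^ 2 + δ ^ 2 := by positivity

lemma contDiff_sqrt_sq_add_sq (hδ : 0 < δ) :
    ContDiff ℝ 1 fun s : ℝ => Real.sqrt (s ^ 2 + δ ^ 2) :=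
  ((contDiff_id.pow 2).add contDiff_const).sqrt fun s => (sq_add_sq_pos' hδ s).ne'

lemma contDiff_smoothStep (hδ : 0 < δ) : ContDiff ℝ 1 (smoothStep δ) :=
  (contDiff_const.add (contDiff_id.div (contDiff_sqrt_sq_add_sq hδ)
    fun s => (Real.sqrt_pos.2 (sq_add_sq_pos' hδ s)).ne')).div_const 2

lemma contDiff_smoothPos (hδ : 0 < δ) : ContDiff ℝ 1 (smoothPos δ) :=
  (contDiff_id.add (contDiff_sqrt_sq_add_sq hδ)).div_const 2

lemma hasDerivAt_smoothPos (hδ : 0 < δ) (s : ℝ) :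
    HasDerivAt (smoothPos δ) (smoothStep δ s) s := by
  have h1 : HasDerivAt (fun s : ℝ => s ^ 2 + δ ^ 2) (2 * s) s := by
    simpa using (hasDerivAt_pow 2 s).add_const (δ ^ 2)
  have h2 := ((hasDerivAt_id s).add (h1.sqrt (sq_add_sq_pos' hδ s).ne')).div_const 2
  rw [mul_div_mul_left _ _ two_ne_zero] at h2
  exact h2

lemma abs_le_sqrt_sq_add_sq (s : ℝ) : |s| ≤ Real.sqrt (s ^ 2 + δ ^ 2) :=
  Real.abs_le_sqrt (by nlinarith [sq_nonneg δ])

lemma smoothStep_mem (hδ : 0 < δ) (s : ℝ) : 0 ≤ smoothStep δ s ∧ smoothStep δ s ≤ 1 := by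
  have h := abs_le.1 (abs_le_sqrt_sq_add_sq (δ := δ) s)
  have hp := Real.sqrt_pos.2 (sq_add_sq_pos' hδ s)
  have h1 : s / Real.sqrt (s ^ 2 + δ ^ 2) ≤ 1 := (div_le_one hp).2 h.2
  have h2 : -1 ≤ s / Real.sqrt (s ^ 2 + δ ^ 2) := (le_div_iff₀ hp).2 (by linarith [h.1])
  constructor <;> unfold smoothStep <;> linarith

lemma abs_smoothPos_sub_le (hδ : 0 < δ) (s : ℝ) : |smoothPos δ s - max s 0| ≤ δ := by
  have h1 := abs_le_sqrt_sq_add_sq (δ := δ) s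
  have h2 : Real.sqrt (s ^ 2 + δ ^ 2) ≤ |s| + δ := by
    rw [Real.sqrt_le_left (by positivity)]
    nlinarith [sq_abs s, abs_nonneg s]
  have h3 : max s 0 = (s + |s|) / 2 := by
    rcases le_total 0 s with h | h
    · rw [abs_of_nonneg h, max_eq_left h]; ring
    · rw [abs_of_nonpos h, max_eq_right h]; ring
  rw [h3, smoothPos, abs_le]
  constructor <;> linarith

lemma abs_max_zero_sub_le (a b : ℝ) : |max a 0 - max b 0| ≤ |a - b| :=
  abs_max_sub_max_le_abs a b 0

end SmoothPos

/-! ### Submodularity of the perimeter -/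

namespace SubFinslerGroup

variable {d k : ℕ} {S : SubFinslerGroup d k}

/-- With `θ` the smooth step of `f - g`, the smoothed maximum and minimum have differentials `θ df +
(1 - θ) dg` and `(1 - θ) df + θ dg`. Regrouping by `df` and `dg` pairs `f` with `θ U + (1 - θ) V`
and `g` with `θ V + (1 - θ) U`, both admissible by convexity. -/
lemma integral_smooth_submodular {U V : Rd d → Rd d} (hU : S.Admissible U) (hV : S.Admissible V)
    {f g : Rd d → ℝ} (hf : ContDiff ℝ 1 f) (hg : ContDiff ℝ 1 g) {a b δ : ℝ} (hδ : 0 < δ)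
    (hfa : ∀ W, S.Admissible W → ∫ x, f x * euclideanDiv W x ≤ a)
    (hgb : ∀ W, S.Admissible W → ∫ x, g x * euclideanDiv W x ≤ b) :
    (∫ x, (g x + smoothPos δ (f x - g x)) * euclideanDiv U x) +
      ∫ x, (f x - smoothPos δ (f x - g x)) * euclideanDiv V x ≤ a + b := by
  set θ : Rd d → ℝ := fun x => smoothStep δ (f x - g x) with hθ
  set P : Rd d → ℝ := fun x => smoothPos δ (f x - g x) with hP
  have hθd : ContDiff ℝ 1 θ := (contDiff_smoothStep hδ).comp (hf.sub hg)
  have hPd : ContDiff ℝ 1 P := (contDiff_smoothPos hδ).comp (hf.sub hg)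
  have h0 : ∀ x, 0 ≤ θ x := fun x => (smoothStep_mem hδ _).1
  have h1 : ∀ x, θ x ≤ 1 := fun x => (smoothStep_mem hδ _).2
  have hW1 := hU.combine hV hθd h0 h1
  have hW2 := hV.combine hU hθd h0 h1
  have hfx : ∀ x, HasFDerivAt f (fderiv ℝ f x) x := fun x =>
    (hf.differentiable (by simp) x).hasFDerivAt
  have hgx : ∀ x, HasFDerivAt g (fderiv ℝ g x) x := fun x =>
    (hg.differentiable (by simp) x).hasFDerivAt
  have hPx : ∀ x, HasFDerivAt P (θ x • (fderiv ℝ f x - fderiv ℝ g x)) x := fun x =>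
    (hasDerivAt_smoothPos hδ _).comp_hasFDerivAt x ((hfx x).sub (hgx x))
  have hint : ∀ {φ : Rd d → ℝ} {W : Rd d → Rd d}, ContDiff ℝ 1 φ → S.Admissible W →
      Integrable fun x => fderiv ℝ φ x (W x) := fun {φ W} hφ hW =>
    ((hφ.continuous_fderiv (by simp)).clm_apply hW.1.continuous).integrable_of_hasCompactSupport
      (hW.2.1.mono fun x hx => by
        contrapose! hx
        have : W x = 0 := by simpa using hx
        simp [this])
  have key : (∫ x, (g x + P x) * euclideanDiv U x) + ∫ x, (f x - P x) * euclideanDiv V x =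
      (∫ x, f x * euclideanDiv (fun x => θ x • U x + (1 - θ x) • V x) x) +
        ∫ x, g x * euclideanDiv (fun x => θ x • V x + (1 - θ x) • U x) x := by
    rw [integral_mul_euclideanDiv hf hW1.1 hW1.2.1, integral_mul_euclideanDiv hg hW2.1 hW2.2.1,
      integral_mul_euclideanDiv (φ := fun x => g x + P x) (hg.add hPd) hU.1 hU.2.1,
      integral_mul_euclideanDiv (φ := fun x => f x - P x) (hf.sub hPd) hV.1 hV.2.1,
      ← neg_add, ← neg_add, ← integral_add (hint (hg.add hPd) hU) (hint (hf.sub hPd) hV),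
      ← integral_add (hint hf hW1) (hint hg hW2)]
    congr 1
    refine integral_congr_ae (Filter.Eventually.of_forall fun x => ?_)
    beta_reduce
    rw [((hgx x).fun_add (hPx x)).fderiv, ((hfx x).fun_sub (hPx x)).fderiv]
    simp only [add_apply, sub_apply, smul_apply, map_add, map_smul, smul_eq_mul]
    ring
  rw [key]
  exact add_le_add (hfa _ hW1) (hgb _ hW2)

/-- If `m` is close to the indicator function of `C`, then the integrals of a divergence over `C`
and against `m` are close. -/
lemma setIntegral_le_integral_mul_add {U : Rd d → Rd d} (hU : S.Admissible U) {C : Set (Rd d)}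
    (hC : MeasurableSet C) {m e : Rd d → ℝ} (hm : Continuous m) (he : Integrable e) {δ M L : ℝ}
    (hM : ∀ x, |euclideanDiv U x| ≤ M)
    (hL : ∫ x, |euclideanDiv U x| ≤ L) (hδ : 0 ≤ δ)
    (hme : ∀ x, |m x - C.indicator 1 x| ≤ |e x| + δ) :
    ∫ x in C, euclideanDiv U x ≤ (∫ x, m x * euclideanDiv U x) + (M * (∫ x, |e x|) + δ * L) := by
  have hUi := integrable_euclideanDiv hU.1 hU.2.1
  have hM0 : 0 ≤ M := (abs_nonneg _).trans (hM 0)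
  have h1 : ∫ x in C, euclideanDiv U x = ∫ x, C.indicator 1 x * euclideanDiv U x := by
    rw [← integral_indicator hC]
    refine integral_congr_ae (Filter.Eventually.of_forall fun x => ?_)
    by_cases hx : x ∈ C <;> simp [hx]
  have hi1 : Integrable fun x => C.indicator (1 : Rd d → ℝ) x * euclideanDiv U x :=
    hUi.bdd_mul (c := 1) (measurable_one.indicator hC).aestronglyMeasurable
      (Filter.Eventually.of_forall fun x => NilpotentGroup.abs_indicator_one_le x)
  have hi2 : Integrable fun x => m x * euclideanDiv U x :=
    (hm.mul (continuous_euclideanDiv hU.1)).integrable_of_hasCompactSupport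
      (hasCompactSupport_euclideanDiv hU.2.1).mul_left
  have hi3 : Integrable fun x => M * |e x| + δ * |euclideanDiv U x| :=
    (he.abs.const_mul M).add (hUi.abs.const_mul δ)
  have h2 : ∫ x, C.indicator 1 x * euclideanDiv U x ≤
      ∫ x, (m x * euclideanDiv U x + (M * |e x| + δ * |euclideanDiv U x|)) := by
    refine integral_mono hi1 (hi2.add hi3) fun x => ?_
    have h3 : (C.indicator 1 x - m x) * euclideanDiv U x ≤
        (|e x| + δ) * |euclideanDiv U x| := by
      refine (le_abs_self _).trans ?_
      rw [abs_mul, abs_sub_comm]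
      exact mul_le_mul_of_nonneg_right (hme x) (abs_nonneg _)
    have h4 : |e x| * |euclideanDiv U x| ≤ |e x| * M :=
      mul_le_mul_of_nonneg_left (hM x) (abs_nonneg _)
    beta_reduce
    nlinarith
  rw [integral_add hi2 hi3, integral_add (he.abs.const_mul M) (hUi.abs.const_mul δ),
    integral_const_mul, integral_const_mul] at h2
  rw [h1]
  have := mul_le_mul_of_nonneg_left hL hδ
  linarith

lemma Admissible.exists_abs_euclideanDiv_le {U : Rd d → Rd d} (hU : S.Admissible U) :
    ∃ M, ∀ x, |euclideanDiv U x| ≤ M :=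
  (continuous_euclideanDiv hU.1).bounded_above_of_compact_support
    (hasCompactSupport_euclideanDiv hU.2.1)

lemma indicator_union_eq (A B : Set (Rd d)) (x : Rd d) : (A ∪ B).indicator (1 : Rd d → ℝ) x =
    B.indicator 1 x + max (A.indicator 1 x - B.indicator 1 x) 0 := by
  by_cases hA : x ∈ A <;> by_cases hB : x ∈ B <;> simp [hA, hB]

lemma indicator_inter_eq (A B : Set (Rd d)) (x : Rd d) : (A ∩ B).indicator (1 : Rd d → ℝ) x =
    A.indicator 1 x - max (A.indicator 1 x - B.indicator 1 x) 0 := by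
  by_cases hA : x ∈ A <;> by_cases hB : x ∈ B <;> simp [hA, hB]

/-- The perimeter is submodular. -/
theorem perimeter_union_add_perimeter_inter_le {A B : Set (Rd d)} (hA : MeasurableSet A)
    (hB : MeasurableSet B) (hAf : volume A < ⊤) (hBf : volume B < ⊤)
    (hPA : S.perimeter A < ⊤) (hPB : S.perimeter B < ⊤) :
    S.perimeter (A ∪ B) + S.perimeter (A ∩ B) ≤ S.perimeter A + S.perimeter B := by
  have main : ∀ U V, S.Admissible U → S.Admissible V →
      (∫ x in A ∪ B, euclideanDiv U x) + ∫ x in A ∩ B, euclideanDiv V x ≤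
        (S.perimeter A).toReal + (S.perimeter B).toReal := by
    intro U V hU hV
    obtain ⟨M, hM⟩ := hU.exists_abs_euclideanDiv_le
    obtain ⟨N, hN⟩ := hV.exists_abs_euclideanDiv_le
    have hM0 : 0 ≤ M := (abs_nonneg _).trans (hM 0)
    have hN0 : 0 ≤ N := (abs_nonneg _).trans (hN 0)
    set L := ∫ x, |euclideanDiv U x| with hL
    set L' := ∫ x, |euclideanDiv V x| with hL'
    have hL0 : 0 ≤ L := integral_nonneg fun x => abs_nonneg _
    have hL0' : 0 ≤ L' := integral_nonneg fun x => abs_nonneg _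
    -- Error budget per unit of `δ`. The error `e` has `L¹` norm at most `4 δ` (two approximations,
    -- each within `δ` and with weight `2`) and is multiplied by the supremum of the divergence;
    -- smoothing the positive part costs `δ` times its `L¹` norm.
    set c := 4 * M + L + (4 * N + L') with hc
    have hc0 : 0 ≤ c := by positivity
    have hstep : ∀ δ, 0 < δ → (∫ x in A ∪ B, euclideanDiv U x) + ∫ x in A ∩ B, euclideanDiv V x ≤
        (S.perimeter A).toReal + (S.perimeter B).toReal + c * δ := by
      intro δ hδ
      obtain ⟨f, hf, hfa, hfi, hfd⟩ := exists_contDiff_approx hA hAf hPA hδ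
      obtain ⟨g, hg, hgb, hgi, hgd⟩ := exists_contDiff_approx hB hBf hPB hδ
      have hs := integral_smooth_submodular hU hV hf hg hδ hfa hgb
      set e : Rd d → ℝ := fun x => 2 * |f x - A.indicator 1 x| + 2 * |g x - B.indicator 1 x|
        with he
      have hei : Integrable e := (hfi.abs.const_mul 2).add (hgi.abs.const_mul 2)
      have he0 : ∀ x, |e x| = e x := fun x => abs_of_nonneg (by positivity)
      have hed : ∫ x, |e x| ≤ 4 * δ := by
        simp only [he0]
        rw [he, integral_add (hfi.abs.const_mul 2) (hgi.abs.const_mul 2), integral_const_mul,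
          integral_const_mul]
        linarith
      have hPc : Continuous fun x => smoothPos δ (f x - g x) :=
        (contDiff_smoothPos hδ).continuous.comp (hf.continuous.sub hg.continuous)
      have hcmp : ∀ x, |smoothPos δ (f x - g x) -
          max (A.indicator 1 x - B.indicator 1 x) 0| ≤
          |f x - A.indicator 1 x| + |g x - B.indicator 1 x| + δ := by
        intro x
        have h1 := abs_smoothPos_sub_le hδ (f x - g x)
        have h2 := abs_max_zero_sub_le (f x - g x) (A.indicator 1 x - B.indicator 1 x)
        have h3 : |f x - g x - (A.indicator 1 x - B.indicator 1 x)| ≤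
            |f x - A.indicator 1 x| + |g x - B.indicator 1 x| := by
          rw [show f x - g x - (A.indicator 1 x - B.indicator 1 x) =
            (f x - A.indicator 1 x) - (g x - B.indicator 1 x) by ring]
          exact abs_sub _ _
        have h4 := abs_sub_le (smoothPos δ (f x - g x)) (max (f x - g x) 0)
          (max (A.indicator 1 x - B.indicator 1 x) 0)
        linarith
      have hU' := setIntegral_le_integral_mul_add hU (hA.union hB) (hg.continuous.add hPc) hei hM
        hL.ge hδ.le fun x => by
          rw [indicator_union_eq, he0, Pi.add_apply]
          rw [show g x + smoothPos δ (f x - g x) - (B.indicator 1 x +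
            max (A.indicator 1 x - B.indicator 1 x) 0) = (g x - B.indicator 1 x) +
            (smoothPos δ (f x - g x) - max (A.indicator 1 x - B.indicator 1 x) 0) by ring]
          refine (abs_add_le _ _).trans ?_
          have := hcmp x
          have := abs_nonneg (f x - A.indicator 1 x)
          simp only [he]
          linarith
      have hV' := setIntegral_le_integral_mul_add hV (hA.inter hB) (hf.continuous.sub hPc) hei hN
        hL'.ge hδ.le fun x => by
          rw [indicator_inter_eq, he0, Pi.sub_apply]
          rw [show f x - smoothPos δ (f x - g x) - (A.indicator 1 x -
            max (A.indicator 1 x - B.indicator 1 x) 0) = (f x - A.indicator 1 x) -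
            (smoothPos δ (f x - g x) - max (A.indicator 1 x - B.indicator 1 x) 0) by ring]
          refine (abs_sub _ _).trans ?_
          have := hcmp x
          have := abs_nonneg (g x - B.indicator 1 x)
          simp only [he]
          linarith
      simp only [Pi.add_apply, Pi.sub_apply] at hU' hV'
      have h1 := mul_le_mul_of_nonneg_left hed hM0
      have h2 := mul_le_mul_of_nonneg_left hed hN0
      have h3 : c * δ = M * (4 * δ) + δ * L + (N * (4 * δ) + δ * L') := by rw [hc]; ring
      linarith
    refine le_of_forall_pos_le_add fun ε hε => ?_
    refine (hstep (ε / (c + 1)) (by positivity)).trans ?_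
    have : c * (ε / (c + 1)) ≤ ε := by
      rw [mul_div_assoc', div_le_iff₀ (by positivity)]
      nlinarith
    linarith
  have hz : ∀ C : Set (Rd d), ∫ x in C, euclideanDiv (0 : Rd d → Rd d) x = 0 := by
    intro C
    have : euclideanDiv (0 : Rd d → Rd d) = 0 := by
      funext p; simp [euclideanDiv]
    simp [this]
  rw [← ENNReal.ofReal_toReal hPA.ne, ← ENNReal.ofReal_toReal hPB.ne,
    ← ENNReal.ofReal_add ENNReal.toReal_nonneg ENNReal.toReal_nonneg]
  rw [perimeter, perimeter]
  refine ENNReal.biSup_add_biSup_le' ⟨0, Admissible.zero⟩ ⟨0, Admissible.zero⟩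
    fun U hU V hV => ?_
  rw [S.divergence_eq hU.1, S.divergence_eq hV.1]
  -- `ENNReal.ofReal` truncates negative integrals to `0`, which amounts to replacing the field by
  -- the admissible field `0`.
  rcases le_total 0 (∫ x in A ∪ B, euclideanDiv U x) with hu | hu <;>
    rcases le_total 0 (∫ x in A ∩ B, euclideanDiv V x) with hv | hv
  · rw [← ENNReal.ofReal_add hu hv]
    exact ENNReal.ofReal_le_ofReal (main U V hU hV)
  · rw [ENNReal.ofReal_of_nonpos hv, add_zero]
    refine ENNReal.ofReal_le_ofReal ?_
    have := main U 0 hU Admissible.zero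
    rwa [hz, add_zero] at this
  · rw [ENNReal.ofReal_of_nonpos hu, zero_add]
    refine ENNReal.ofReal_le_ofReal ?_
    have := main 0 V Admissible.zero hV
    rwa [hz, zero_add] at this
  · rw [ENNReal.ofReal_of_nonpos hu, ENNReal.ofReal_of_nonpos hv, add_zero]
    exact zero_le

end SubFinslerGroup

/-! ### Nonnegative midpoint concave functions -/

/-- Midpoint concavity on the positive half-line. -/
def MidpointConcavePos (I : ℝ → ℝ) : Prop :=
  ∀ v s, 0 < s → s < v → I (v + s) + I (v - s) ≤ 2 * I v

namespace MidpointConcavePos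

variable {I : ℝ → ℝ}

lemma increment_succ_le (hI : MidpointConcavePos I) {a h : ℝ} (ha : 0 < a) (hh : 0 < h) (n : ℕ) :
    I (a + (n + 2) * h) - I (a + (n + 1) * h) ≤ I (a + (n + 1) * h) - I (a + n * h) := by
  have hn : (0 : ℝ) ≤ n := n.cast_nonneg
  have := hI (a + (n + 1) * h) h hh (by nlinarith)
  rw [show a + (n + 1) * h + h = a + (n + 2) * h by ring,
    show a + (n + 1) * h - h = a + n * h by ring] at this
  linarith

lemma increment_le (hI : MidpointConcavePos I) {a h : ℝ} (ha : 0 < a) (hh : 0 < h) (n : ℕ) :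
    I (a + (n + 1) * h) - I (a + n * h) ≤ I (a + h) - I a := by
  induction n with
  | zero => simp
  | succ n ih =>
    refine le_trans ?_ ih
    have := hI.increment_succ_le ha hh n
    push_cast
    rwa [show (n : ℝ) + 1 + 1 = n + 2 by ring]

lemma le_add_mul_increment (hI : MidpointConcavePos I) {a h : ℝ} (ha : 0 < a) (hh : 0 < h)
    (n : ℕ) : I (a + n * h) ≤ I a + n * (I (a + h) - I a) := by
  induction n with
  | zero => simp
  | succ n ih =>
    have := hI.increment_le ha hh n
    push_cast
    linarith

/-- Increments along an arithmetic progression decrease, so `n` times the next one is at most the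
sum of the `n` preceding ones. -/
lemma mul_increment_le (hI : MidpointConcavePos I) {a h : ℝ} (ha : 0 < a) (hh : 0 < h) (n : ℕ) :
    n * (I (a + (n + 1) * h) - I (a + n * h)) ≤ I (a + n * h) - I a := by
  induction n with
  | zero => simp
  | succ n ih =>
    have h1 := hI.increment_succ_le ha hh n
    have hn : (0 : ℝ) ≤ n + 1 := by positivity
    have h2 := mul_le_mul_of_nonneg_left h1 hn
    push_cast
    rw [show (n : ℝ) + 1 + 1 = n + 2 by ring]
    linarith

/-- A decrease from `a` to `b` would persist at every later step of length `b - a`, and the function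
would become negative. -/
lemma mono (hI : MidpointConcavePos I) (h0 : ∀ v, 0 ≤ I v) {a b : ℝ} (ha : 0 < a) (hab : a ≤ b) :
    I a ≤ I b := by
  rcases hab.eq_or_lt with rfl | hlt
  · exact le_rfl
  by_contra! hcon
  obtain ⟨n, hn⟩ := exists_nat_gt (I a / (I a - I b))
  have h1 := hI.le_add_mul_increment ha (sub_pos.2 hlt) n
  rw [add_sub_cancel] at h1
  rw [div_lt_iff₀ (sub_pos.2 hcon)] at hn
  have h2 := h0 (a + n * (b - a))
  linarith

lemma exists_le_add_mul_abs (hI : MidpointConcavePos I) (h0 : ∀ v, 0 ≤ I v) {v : ℝ} (hv : 0 < v) :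
    ∃ C, 0 < C ∧ ∀ l, -v < l → I (v + l) ≤ I v + C * |l| := by
  refine ⟨4 * I v / v + 1, by have := h0 v; positivity, fun l hl => ?_⟩
  have hIv := h0 v
  rcases le_or_gt l 0 with hl0 | hl0
  · have h1 := hI.mono h0 (a := v + l) (b := v) (by linarith) (by linarith)
    have : 0 ≤ (4 * I v / v + 1) * |l| := by positivity
    linarith
  rw [abs_of_pos hl0]
  suffices h : I (v + l) - I v ≤ 4 * I v / v * l by nlinarith
  rcases le_or_gt l (v / 2) with hlv | hlv
  · have hy : 1 ≤ v / (2 * l) := by rw [le_div_iff₀ (by positivity)]; linarith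
    set n := ⌊v / (2 * l)⌋₊ with hn
    have hn1 : (n : ℝ) ≤ v / (2 * l) := Nat.floor_le (by positivity)
    have hn2 : v / (2 * l) < n + 1 := Nat.lt_floor_add_one _
    have hn3 : 1 ≤ n := Nat.le_floor (by exact_mod_cast hy)
    have hn3' : (1 : ℝ) ≤ n := by exact_mod_cast hn3
    have hn4 : (n : ℝ) * l ≤ v / 2 := by
      rw [le_div_iff₀ (by positivity)] at hn1; linarith
    have hn5 : v ≤ 4 * (n * l) := by
      rw [div_lt_iff₀ (by positivity)] at hn2; nlinarith
    have h1 := hI.mul_increment_le (a := v - n * l) (h := l) (by linarith) hl0 n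
    rw [show v - n * l + (n + 1) * l = v + l by ring, show v - n * l + n * l = v by ring] at h1
    have h2 := h0 (v - n * l)
    rw [show 4 * I v / v * l = (4 * I v * l) / v by ring, le_div_iff₀ hv]
    rcases le_or_gt (I (v + l) - I v) 0 with h3 | h3
    · have : 0 ≤ 4 * I v * l := by positivity
      nlinarith
    · calc (I (v + l) - I v) * v ≤ (I (v + l) - I v) * (4 * (n * l)) :=
            mul_le_mul_of_nonneg_left hn5 h3.le
        _ = 4 * l * (n * (I (v + l) - I v)) := by ring
        _ ≤ 4 * l * I v := mul_le_mul_of_nonneg_left (by linarith) (by positivity)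
        _ = 4 * I v * l := by ring
  -- For large `l`, cover `[v, v + l]` by `n ≤ 4 l / v` steps of length `v / 2`. Each raises the
  -- function by at most `I(v) - I(v / 2) ≤ I(v)`.
  · set n := ⌈l / (v / 2)⌉₊ with hn
    have hy : 1 < l / (v / 2) := by rw [lt_div_iff₀ (by positivity)]; linarith
    have hn1 : l / (v / 2) ≤ n := Nat.le_ceil _
    have hn2 : (n : ℝ) < l / (v / 2) + 1 := Nat.ceil_lt_add_one (by linarith)
    have hn3 : l ≤ n * (v / 2) := (div_le_iff₀ (by positivity)).1 hn1
    have hn4 : (n : ℝ) ≤ 4 * l / v := by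
      have : 4 * l / v = 2 * (l / (v / 2)) := by field_simp; norm_num
      linarith
    have h1 := hI.mono h0 (a := v + l) (b := v + n * (v / 2)) (by linarith) (by linarith)
    have h2 := hI.le_add_mul_increment hv (half_pos hv) n
    have h3 := hI v (v / 2) (half_pos hv) (half_lt_self hv)
    have h4 := h0 (v - v / 2)
    have h5 : (n : ℝ) * (I (v + v / 2) - I v) ≤ n * I v :=
      mul_le_mul_of_nonneg_left (by linarith) n.cast_nonneg
    have h6 : (n : ℝ) * I v ≤ 4 * l / v * I v := mul_le_mul_of_nonneg_right hn4 hIv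
    have h7 : 4 * l / v * I v = 4 * I v / v * l := by ring
    linarith

end MidpointConcavePos

/-! ### Overlap of a set with its translates -/

namespace NilpotentGroup

open Filter Topology

variable {d : ℕ} (G : NilpotentGroup d)

lemma continuous_measureReal_inter_preimage {E : Set (Rd d)} (hE : MeasurableSet E)
    (hfin : volume E < ⊤) : Continuous fun g => volume.real (E ∩ G.mul g ⁻¹' E) := by
  rw [continuous_iff_continuousAt]
  intro g₀
  have hpre : ∀ g, MeasurableSet (G.mul g ⁻¹' E) := fun g =>
    (G.continuous_mul_left g).measurable hE
  have hvol : ∀ g, volume (G.mul g ⁻¹' E) = volume E := fun g =>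
    (G.measurePreserving_mul_left g).measure_preimage hE.nullMeasurableSet
  have hlim : Tendsto (fun g => volume.real (symmDiff (G.mul g ⁻¹' E) (G.mul g₀ ⁻¹' E)))
      (𝓝 g₀) (𝓝 0) := by
    have h := (ENNReal.tendsto_toReal ENNReal.zero_ne_top).comp
      (G.tendsto_volume_symmDiff_preimage hE hfin g₀)
    rw [ENNReal.toReal_zero] at h
    exact h
  have hne : ∀ A : Set (Rd d), volume (E ∩ A) ≠ ⊤ := fun A =>
    ((measure_mono Set.inter_subset_left).trans_lt hfin).ne
  rw [ContinuousAt, tendsto_iff_dist_tendsto_zero]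
  refine squeeze_zero (fun g => dist_nonneg) (fun g => ?_) hlim
  have hsd : volume (symmDiff (G.mul g ⁻¹' E) (G.mul g₀ ⁻¹' E)) ≠ ⊤ := by
    refine ((measure_mono Set.symmDiff_subset_union).trans_lt ?_).ne
    refine (measure_union_le _ _).trans_lt ?_
    rw [hvol, hvol]
    exact ENNReal.add_lt_top.2 ⟨hfin, hfin⟩
  rw [Real.dist_eq]
  refine (abs_measureReal_sub_le_measureReal_symmDiff' (hE.inter (hpre g)).nullMeasurableSet
    (hE.inter (hpre g₀)).nullMeasurableSet (hne _) (hne _)).trans ?_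
  refine measureReal_mono ?_ hsd
  rw [← Set.inter_symmDiff_distrib_left]
  exact Set.inter_subset_right

lemma exists_measureReal_inter_preimage_le {E : Set (Rd d)} (hE : MeasurableSet E)
    (hfin : volume E < ⊤) {x : Rd d} (hx : x ≠ 0) {ε : ℝ} (hε : 0 < ε) :
    ∃ t : ℝ, 0 ≤ t ∧ volume.real (E ∩ G.mul (t • x) ⁻¹' E) ≤ ε := by
  obtain ⟨K, hKE, hK, hKε⟩ := hE.exists_isCompact_sdiff_lt hfin.ne
    (ε := ENNReal.ofReal (ε / 2)) (by simpa using hε)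
  have hD : IsCompact ((fun p : Rd d × Rd d => G.mul p.1 (-p.2)) '' (K ×ˢ K)) :=
    (hK.prod hK).image (G.continuous_mul.comp (continuous_fst.prodMk continuous_snd.neg))
  obtain ⟨R, hR0, hR⟩ := hD.isBounded.exists_pos_norm_le
  -- The translation has norm `R + 1`, larger than any `a · (-b)` with `a, b ∈ K`, so it sends no
  -- point of `K` into `K`. The overlap then lies in `E \ K` and its translate.
  refine ⟨(R + 1) / ‖x‖, by positivity, ?_⟩
  set g := ((R + 1) / ‖x‖) • x with hg
  have hgn : ‖g‖ = R + 1 := by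
    rw [hg, norm_smul, Real.norm_of_nonneg (by positivity), div_mul_cancel₀ _ (norm_ne_zero_iff.2 hx)]
  have hsub : E ∩ G.mul g ⁻¹' E ⊆ (E \ K) ∪ G.mul g ⁻¹' (E \ K) := by
    rintro y ⟨hy1, hy2⟩
    by_cases hyK : y ∈ K
    · refine Or.inr ⟨hy2, fun hyK2 => ?_⟩
      have h1 := hR _ ⟨(G.mul g y, y), ⟨hyK2, hyK⟩, rfl⟩
      simp only [G.mul_assoc, G.mul_neg_self, G.mul_zero, hgn] at h1
      linarith
    · exact Or.inl ⟨hy1, hyK⟩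
  refine ENNReal.toReal_le_of_le_ofReal hε.le ?_
  calc volume (E ∩ G.mul g ⁻¹' E) ≤ volume (E \ K) + volume (G.mul g ⁻¹' (E \ K)) :=
        (measure_mono hsub).trans (measure_union_le _ _)
    _ = volume (E \ K) + volume (E \ K) := by
        rw [(G.measurePreserving_mul_left g).measure_preimage
          (hE.diff hK.measurableSet).nullMeasurableSet]
    _ ≤ ENNReal.ofReal (ε / 2) + ENNReal.ofReal (ε / 2) := add_le_add hKε.le hKε.le
    _ = ENNReal.ofReal ε := by
        rw [← ENNReal.ofReal_add (by positivity) (by positivity), add_halves]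

/-- Every intermediate value is the measure of the intersection of `E` with a translate. -/
lemma exists_measureReal_inter_preimage_eq (hd : 0 < d) {E : Set (Rd d)} (hE : MeasurableSet E)
    (hfin : volume E < ⊤) {w : ℝ} (hw0 : 0 < w) (hw : w ≤ volume.real E) :
    ∃ g, volume.real (E ∩ G.mul g ⁻¹' E) = w := by
  set x : Rd d := EuclideanSpace.single ⟨0, hd⟩ 1 with hx
  have hx0 : x ≠ 0 := by simp [hx]
  obtain ⟨t, ht0, ht⟩ := G.exists_measureReal_inter_preimage_le hE hfin hx0 hw0
  have hc : Continuous fun t : ℝ => volume.real (E ∩ G.mul (t • x) ⁻¹' E) :=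
    (G.continuous_measureReal_inter_preimage hE hfin).comp (continuous_id.smul continuous_const)
  have h0 : E ∩ G.mul ((0 : ℝ) • x) ⁻¹' E = E := by
    ext y; simp [G.zero_mul]
  obtain ⟨r, -, hr⟩ := intermediate_value_Icc' ht0 hc.continuousOn
    ⟨ht, by simpa only [h0] using hw⟩
  exact ⟨r • x, hr⟩

end NilpotentGroup

/-! ### The isoperimetric profile -/

namespace SubFinslerGroup

variable {d k : ℕ} (S : SubFinslerGroup d k)

/-- The perimeters of the sets of measure `v` and finite perimeter. -/
def perimeterValues (v : ℝ) : Set ℝ :=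
  {p | ∃ E, MeasurableSet E ∧ volume E < ⊤ ∧ volume.real E = v ∧ S.perimeter E < ⊤ ∧
    (S.perimeter E).toReal = p}

/-- The isoperimetric profile. -/
noncomputable def profile (v : ℝ) : ℝ := sInf (S.perimeterValues v)

variable {S}

/-- The two sets are `E ∩ A` and `E ∪ A` for a translate `A` with `|E ∩ A| = v - s`;
inclusion-exclusion gives the measure of the union, and submodularity the bound. -/
lemma exists_perimeterValues_add_sub (hd : 0 < d) {v s p : ℝ} (hp : p ∈ S.perimeterValues v)
    (hs : 0 < s) (hsv : s < v) :
    ∃ q ∈ S.perimeterValues (v + s), ∃ r ∈ S.perimeterValues (v - s), q + r ≤ 2 * p := by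
  obtain ⟨E, hE, hfin, rfl, hP, rfl⟩ := hp
  obtain ⟨g, hg⟩ := S.exists_measureReal_inter_preimage_eq hd hE hfin
    (w := volume.real E - s) (by linarith) (by linarith)
  set A := S.mul g ⁻¹' E with hA
  have hAm : MeasurableSet A := (S.continuous_mul_left g).measurable hE
  have hAv : volume A = volume E :=
    (S.measurePreserving_mul_left g).measure_preimage hE.nullMeasurableSet
  have hAf : volume A < ⊤ := hAv ▸ hfin
  have hAP : S.perimeter A ≤ S.perimeter E := perimeter_preimage_mul_left_le g E
  have hAP' : S.perimeter A < ⊤ := hAP.trans_lt hP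
  have hsub := perimeter_union_add_perimeter_inter_le hE hAm hfin hAf hP hAP'
  have hlt : S.perimeter (E ∪ A) + S.perimeter (E ∩ A) < ⊤ :=
    hsub.trans_lt (ENNReal.add_lt_top.2 ⟨hP, hAP'⟩)
  obtain ⟨h1, h2⟩ := ENNReal.add_lt_top.1 hlt
  have hAr : volume.real A = volume.real E := congrArg ENNReal.toReal hAv
  have hui := measureReal_union_add_inter (μ := volume) (s := E) hAm hfin.ne hAf.ne
  refine ⟨_, ⟨E ∪ A, hE.union hAm, measure_union_lt_top hfin hAf, by linarith, h1, rfl⟩,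
    _, ⟨E ∩ A, hE.inter hAm, (measure_mono Set.inter_subset_left).trans_lt hfin, hg, h2, rfl⟩, ?_⟩
  have h3 := ENNReal.toReal_mono (ENNReal.add_lt_top.2 ⟨hP, hAP'⟩).ne hsub
  rw [ENNReal.toReal_add h1.ne h2.ne, ENNReal.toReal_add hP.ne hAP'.ne] at h3
  have h4 := ENNReal.toReal_mono hP.ne hAP
  linarith

lemma bddBelow_perimeterValues (v : ℝ) : BddBelow (S.perimeterValues v) := by
  refine ⟨0, ?_⟩
  rintro p ⟨E, -, -, -, -, rfl⟩
  exact ENNReal.toReal_nonneg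

lemma profile_nonneg (v : ℝ) : 0 ≤ S.profile v := by
  refine Real.sInf_nonneg ?_
  rintro p ⟨E, -, -, -, -, rfl⟩
  exact ENNReal.toReal_nonneg

/-- The infimum of an empty set of reals is `0` by convention, so the profile is meaningful only
where competitors exist. Intersections with translates give smaller measures and unions give larger
ones. -/
lemma perimeterValues_nonempty (hd : 0 < d) {v₀ : ℝ} (h₀ : (S.perimeterValues v₀).Nonempty)
    (hv₀ : 0 < v₀) {v : ℝ} (hv : 0 < v) : (S.perimeterValues v).Nonempty := by
  have hle : ∀ n : ℕ, ∀ w, 0 < w → w ≤ (3 / 2) ^ n * v₀ → (S.perimeterValues w).Nonempty := by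
    intro n
    induction n with
    | zero =>
      intro w hw hwv
      rw [pow_zero, one_mul] at hwv
      rcases hwv.eq_or_lt with rfl | hlt
      · exact h₀
      obtain ⟨p, hp⟩ := h₀
      obtain ⟨-, -, r, hr, -⟩ := exists_perimeterValues_add_sub hd hp
        (s := v₀ - w) (by linarith) (by linarith)
      rw [sub_sub_cancel] at hr
      exact ⟨r, hr⟩
    | succ n ih =>
      intro w hw hwv
      -- A union with a translate enlarges the measure by any factor below `2`; here the factor is
      -- `3 / 2`.
      obtain ⟨p, hp⟩ := ih (2 / 3 * w) (by positivity) (by rw [pow_succ] at hwv; linarith)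
      obtain ⟨q, hq, -⟩ := exists_perimeterValues_add_sub hd hp
        (s := w / 3) (by positivity) (by linarith)
      rw [show 2 / 3 * w + w / 3 = w by ring] at hq
      exact ⟨q, hq⟩
  obtain ⟨n, hn⟩ := pow_unbounded_of_one_lt (v / v₀) (by norm_num : (1 : ℝ) < 3 / 2)
  exact hle n v hv ((div_lt_iff₀ hv₀).1 hn).le

lemma midpointConcavePos_profile (hd : 0 < d)
    (hne : ∀ v, 0 < v → (S.perimeterValues v).Nonempty) : MidpointConcavePos S.profile := by
  intro v s hs hsv
  have h : (S.profile (v + s) + S.profile (v - s)) / 2 ≤ S.profile v := by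
    refine le_csInf (hne v (hs.trans hsv)) fun p hp => ?_
    obtain ⟨q, hq, r, hr, hqr⟩ := exists_perimeterValues_add_sub hd hp hs hsv
    have h1 := csInf_le (bddBelow_perimeterValues _) hq
    have h2 := csInf_le (bddBelow_perimeterValues _) hr
    simp only [profile]
    linarith
  linarith

end SubFinslerGroup

/-! ### The family of sets -/

theorem lemma3p4 {d k : ℕ} (hd : 0 < d) (S : SubFinslerGroup d k) (F : Set (Rd d))
    (hF : S.FinitePerimeter F) (hvol : volume F < ⊤) (hint : (interior F).Nonempty) :
    ∃ (C₃ l₀ : ℝ) (l₁ : EReal) (Fam : ℝ → Set (Rd d)),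
      0 < C₃ ∧ 0 < l₀ ∧ 0 < l₁ ∧ (Bornology.IsBounded F → l₁ = ⊤) ∧
      ∀ l : ℝ, -l₀ < l → (l : EReal) < l₁ →
        S.FinitePerimeter (Fam l) ∧
        volume (Fam l) < ⊤ ∧
        (volume (Fam l)).toReal = (volume F).toReal + l ∧
        (S.perimeter (Fam l)).toReal - (S.perimeter F).toReal ≤ C₃ * |l| := by
  obtain ⟨F', -, hF', hFF'⟩ := hF.1.exists_measurable_superset_ae_eq
  set v := (volume F).toReal with hv
  have hv0 : 0 < v := ENNReal.toReal_pos
    ((isOpen_interior.measure_pos volume hint).trans_le (measure_mono interior_subset)).ne' hvol.ne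
  have hPF : S.perimeter F' = S.perimeter F := SubFinslerGroup.perimeter_congr_ae hFF'
  have hVF : volume F' = volume F := measure_congr hFF'
  have hmem : (S.perimeter F).toReal ∈ S.perimeterValues v :=
    ⟨F', hF', hVF ▸ hvol, congrArg ENNReal.toReal hVF, hPF ▸ hF.2, by rw [hPF]⟩
  have hne : ∀ w, 0 < w → (S.perimeterValues w).Nonempty := fun w hw =>
    SubFinslerGroup.perimeterValues_nonempty hd ⟨_, hmem⟩ hv0 hw
  obtain ⟨C, hC, hle⟩ := (SubFinslerGroup.midpointConcavePos_profile hd hne).exists_le_add_mul_abs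
    SubFinslerGroup.profile_nonneg hv0
  -- In the constant `C + 1`, `C` bounds the growth of the profile and `1` pays for near-minimizers
  -- with slack `|l|`. At `l = 0` there is no slack and the infimum need not be attained, so `F`
  -- itself is taken. Outside `-v < l` the set is arbitrary.
  have hex : ∀ l : ℝ, ∃ E, -v < l → S.FinitePerimeter E ∧ volume E < ⊤ ∧
      (volume E).toReal = v + l ∧
      (S.perimeter E).toReal - (S.perimeter F).toReal ≤ (C + 1) * |l| := by
    intro l
    rcases eq_or_ne l 0 with rfl | hl
    · exact ⟨F, fun _ => ⟨hF, hvol, by rw [add_zero], by simp⟩⟩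
    by_cases hlv : -v < l
    · obtain ⟨p, ⟨E, hE, hEf, hEv, hEP, rfl⟩, hlt⟩ := exists_lt_of_csInf_lt
        (hne (v + l) (by linarith)) (lt_add_of_pos_right (S.profile (v + l)) (abs_pos.2 hl))
      have h1 := hle l hlv
      have h2 : S.profile v ≤ (S.perimeter F).toReal :=
        csInf_le (SubFinslerGroup.bddBelow_perimeterValues v) hmem
      exact ⟨E, fun _ => ⟨⟨hE.nullMeasurableSet, hEP⟩, hEf, hEv, by linarith⟩⟩
    · exact ⟨∅, fun h => absurd h hlv⟩
  choose Fam hFam using hex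
  exact ⟨C + 1, v, ⊤, Fam, by positivity, hv0, EReal.zero_lt_top, fun _ => rfl,
    fun l hl _ => hFam l hl⟩
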